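/- Let $\mathbb F$ be a field in which $6$ is invertible. A graded Lie algebra is a $\mathbb Z$-graded $\mathbb F$-vector space $L=\bigoplus_n L^{n}$ (the grading is called dimension, written $|x|$) with a bilinear bracket $L^{i}\otimes L^{j}\to L^{i+j}$ satisfying, for homogeneous elements, $[x,y]=-(-1)^{|x||y|}[y,x]$ and $[x,[y,z]]=[[x,y],z]+(-1)^{|x||y|}[y,[x,z]]$. For a graded vector space $V$, the free Lie algebra $\mathbb L V$ is the Lie subalgebra generated by $V$ in the tensor algebra $TV$ with the graded commutator $[a,b]=ab-(-1)^{|a||b|}ba$; a graded Lie algebra is free if it is isomorphic, as a graded Lie algebra, to some $\mathbb L V$. A bigraded Lie algebra is a graded Lie algebra with a decomposition into components of dimension $i$ and degree $j$ $(i,j\in\mathbb Z)$ such that the bracket is additive in both gradings (signs use the dimension only); $L_j$ denotes the component of degree $j$. Theorem. Let $L$ be a bigraded Lie algebra over $\mathbb F$ that is connected (zero in all dimensions $\le 0$) and of finite type (finite-dimensional in each dimension), and suppose that $L=L_0\rtimes\mathbb L L_1$ with $L_0$ in degree $0$ and $L_1$ in degree $1$; that is, the inclusion of $L_1$ extends to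 an isomorphism of graded Lie algebras from $\mathbb L L_1$ onto an ideal of $L$ which is a vector space complement of the Lie subalgebra $L_0$. Let $J\subset L$ be a Lie subalgebra which is graded by dimension (but not necessarily by degree) such that $J\cap L_0=0$. Then $J$ is a free Lie algebra. -/

import Mathlib

open DirectSum

universe u v

/-- A `ℤ`-grading of a vector space `E`: a decomposition `E = ⨁ₙ Eₙ` into subspaces. -/
structure GrSpace (F : Type u) (E : Type v) [Field F] [AddCommGroup E] [Module F E] where
  /-- `part n` is the component `Eₙ`. -/
  part : ℤ → Submodule F E
  isInternal : DirectSum.IsInternal part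

/-- A graded Lie algebra structure on `E` (with Koszul signs). -/
structure GrLie (F : Type u) (E : Type v) [Field F] [AddCommGroup E] [Module F E]
    extends GrSpace F E where
  /-- The bracket. -/
  br : E →ₗ[F] E →ₗ[F] E
  br_mem : ∀ {i j : ℤ} {x y : E}, x ∈ part i → y ∈ part j → br x y ∈ part (i + j)
  anticomm : ∀ {i j : ℤ} {x y : E}, x ∈ part i → y ∈ part j →
    br x y = -((i * j).negOnePow • br y x)
  jacobi : ∀ {i j k : ℤ} {x y z : E}, x ∈ part i → y ∈ part j → z ∈ part k →
    br x (br y z) = br (br x y) z + (i * j).negOnePow • br y (br x z)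

namespace GrSpace

variable {F : Type u} {E : Type v} [Field F] [AddCommGroup E] [Module F E]

/-- Connected: concentrated in positive dimensions. -/
def IsConnected (V : GrSpace F E) : Prop := ∀ i : ℤ, i ≤ 0 → V.part i = ⊥

/-- Finite type: every component is finite-dimensional. -/
def IsFiniteType (V : GrSpace F E) : Prop := ∀ i : ℤ, FiniteDimensional F (V.part i)

/-- A subspace `W` is graded if `W = ⨁ₙ (W ∩ Eₙ)`, i.e. if it is spanned by its homogeneous
elements. -/
def IsHomogeneous (V : GrSpace F E) (W : Submodule F E) : Prop := W ≤ ⨆ n, W ⊓ V.part n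

theorem iSup_part (V : GrSpace F E) : ⨆ n, V.part n = ⊤ :=
  ((isInternal_submodule_iff_iSupIndep_and_iSup_eq_top _).1 V.isInternal).2

/-- The induced grading of a graded subspace. -/
def restrict (V : GrSpace F E) (W : Submodule F E) (hW : V.IsHomogeneous W) : GrSpace F W where
  part n := (V.part n).comap W.subtype
  isInternal := by
    refine isInternal_submodule_of_iSupIndep_of_iSup_eq_top ?_ ?_
    · have hind := ((isInternal_submodule_iff_iSupIndep_and_iSup_eq_top _).1 V.isInternal).1
      intro i
      rw [Submodule.disjoint_def]
      intro x hx hx'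
      have h1 := Submodule.mem_map_of_mem (f := W.subtype) hx'
      simp only [Submodule.map_iSup] at h1
      have h2 : (x : E) ∈ ⨆ j, ⨆ _ : j ≠ i, V.part j :=
        iSup₂_mono (fun j _ => Submodule.map_comap_le _ _) h1
      exact Subtype.ext (Submodule.disjoint_def.1 (hind i) x hx h2)
    · rw [eq_top_iff]
      rintro x -
      have h1 := hW x.2
      have h2 : (⨆ n, W ⊓ V.part n) = (⨆ n, (V.part n).comap W.subtype).map W.subtype := by
        simp [Submodule.map_iSup, Submodule.map_comap_subtype]
      rw [h2] at h1
      obtain ⟨y, hy, hyx⟩ := h1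
      exact (Subtype.ext hyx : y = x) ▸ hy

end GrSpace

namespace GrLie

variable {F : Type u} {E : Type v} [Field F] [AddCommGroup E] [Module F E]

/-- A Lie subalgebra: a subspace closed under the bracket. -/
def IsSubalgebra (L : GrLie F E) (J : Submodule F E) : Prop :=
  ∀ x ∈ J, ∀ y ∈ J, L.br x y ∈ J

/-- A Lie ideal. -/
def IsIdeal (L : GrLie F E) (J : Submodule F E) : Prop :=
  ∀ x ∈ J, ∀ y, L.br x y ∈ J

/-- A graded Lie subalgebra as a graded Lie algebra in its own right. -/
def restrict (L : GrLie F E) (J : Submodule F E) (hJ : L.IsSubalgebra J)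
    (hg : L.IsHomogeneous J) : GrLie F J where
  toGrSpace := L.toGrSpace.restrict J hg
  br := LinearMap.mk₂ F (fun x y => ⟨L.br x y, hJ x x.2 y y.2⟩)
    (fun _ _ _ => Subtype.ext (by simp)) (fun _ _ _ => Subtype.ext (by simp))
    (fun _ _ _ => Subtype.ext (by simp)) (fun _ _ _ => Subtype.ext (by simp))
  br_mem hx hy := L.br_mem hx hy
  anticomm hx hy := Subtype.ext (L.anticomm hx hy)
  jacobi hx hy hz := Subtype.ext (L.jacobi hx hy hz)

/-- The Lie subalgebra generated by a subspace. -/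
def closure (L : GrLie F E) (W : Submodule F E) : Submodule F E :=
  sInf {K | W ≤ K ∧ L.IsSubalgebra K}

theorem le_closure (L : GrLie F E) (W : Submodule F E) : W ≤ L.closure W :=
  le_sInf fun _ hK => hK.1

theorem isSubalgebra_closure (L : GrLie F E) (W : Submodule F E) :
    L.IsSubalgebra (L.closure W) := by
  intro x hx y hy
  simp only [closure, Submodule.mem_sInf] at *
  exact fun K hK => hK.2 x (hx K hK) y (hy K hK)

/-- The Lie subalgebra generated by a graded subspace is graded. -/
theorem isHomogeneous_closure (L : GrLie F E) (W : Submodule F E) (hW : L.IsHomogeneous W) :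
    L.IsHomogeneous (L.closure W) := by
  have hle : (⨆ n, L.closure W ⊓ L.part n) ≤ L.closure W := iSup_le fun n => inf_le_left
  refine sInf_le ⟨hW.trans (iSup_mono fun n => inf_le_inf_right _ (L.le_closure W)), ?_⟩
  intro x hx y hy
  refine Submodule.iSup_induction _ (motive := fun x => L.br x y ∈ _) hx ?_ ?_ ?_
  · intro i x hx
    refine Submodule.iSup_induction _ (motive := fun y => L.br x y ∈ _) hy ?_ ?_ ?_
    · intro j y hy
      exact Submodule.mem_iSup_of_mem (i + j)
        ⟨L.isSubalgebra_closure W x hx.1 y hy.1, L.br_mem hx.2 hy.2⟩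
    · simp
    · intro a b ha hb
      simpa using add_mem ha hb
  · simp
  · intro a b ha hb
    simpa using add_mem ha hb

/-- A homomorphism of graded Lie algebras: a linear map that preserves dimension and bracket. -/
structure Hom {E' : Type*} [AddCommGroup E'] [Module F E'] (L : GrLie F E) (L' : GrLie F E')
    extends E →ₗ[F] E' where
  map_part : ∀ n : ℤ, ∀ x ∈ L.part n, toLinearMap x ∈ L'.part n
  map_br : ∀ x y : E, toLinearMap (L.br x y) = L'.br (toLinearMap x) (toLinearMap y)

section Commutator

variable {A : Type v} [Ring A] [Algebra F A] (𝒜 : ℤ → Submodule F A) [GradedAlgebra 𝒜]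

/-- The linear map `y ↦ (-1)^{i|y|} y`. -/
noncomputable def koszulSign (i : ℤ) : A →ₗ[F] A :=
  (DirectSum.toModule F ℤ A fun j => (i * j).negOnePow • (𝒜 j).subtype) ∘ₗ
    (decomposeLinearEquiv 𝒜).toLinearMap

theorem koszulSign_apply {i j : ℤ} {y : A} (hy : y ∈ 𝒜 j) :
    koszulSign 𝒜 i y = (i * j).negOnePow • y := by
  lift y to 𝒜 j using hy
  rw [koszulSign, LinearMap.comp_apply, LinearEquiv.coe_coe, decomposeLinearEquiv_apply,
    decompose_coe]
  exact (DirectSum.toModule_lof F (M := fun n => 𝒜 n) j y).trans rfl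

/-- The bilinear map `(x, y) ↦ (-1)^{|x||y|} y x`. -/
noncomputable def koszulOp : A →ₗ[F] A →ₗ[F] A :=
  (DirectSum.toModule F ℤ (A →ₗ[F] A) fun i =>
    ((LinearMap.mul F A).flip.compl₂ (koszulSign 𝒜 i)) ∘ₗ (𝒜 i).subtype) ∘ₗ
    (decomposeLinearEquiv 𝒜).toLinearMap

theorem koszulOp_apply {i j : ℤ} {x y : A} (hx : x ∈ 𝒜 i) (hy : y ∈ 𝒜 j) :
    koszulOp 𝒜 x y = (i * j).negOnePow • (y * x) := by
  lift x to 𝒜 i using hx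
  rw [koszulOp, LinearMap.comp_apply, LinearEquiv.coe_coe, decomposeLinearEquiv_apply,
    decompose_coe]
  refine (congrArg (fun g : A →ₗ[F] A => g y) (DirectSum.toModule_lof F (M := fun n => 𝒜 n) i x)).trans ?_
  simp [koszulSign_apply 𝒜 hy]

theorem mul_sub_koszulOp_apply {i j : ℤ} {x y : A} (hx : x ∈ 𝒜 i) (hy : y ∈ 𝒜 j) :
    (LinearMap.mul F A - koszulOp 𝒜) x y = x * y - (i * j).negOnePow • (y * x) := by
  simp [koszulOp_apply 𝒜 hx hy]

/-- A graded associative algebra as a graded Lie algebra under the graded commutator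
`[x, y] = xy - (-1)^{|x||y|} yx`. -/
noncomputable def ofGradedAlgebra : GrLie F A where
  part := 𝒜
  isInternal := Decomposition.isInternal 𝒜
  br := LinearMap.mul F A - koszulOp 𝒜
  br_mem {i j x y} hx hy := by
    rw [mul_sub_koszulOp_apply 𝒜 hx hy]
    refine sub_mem (SetLike.mul_mem_graded hx hy) ?_
    have h : y * x ∈ 𝒜 (i + j) := add_comm j i ▸ SetLike.mul_mem_graded hy hx
    rcases Int.units_eq_one_or (i * j).negOnePow with h1 | h1 <;> rw [h1] <;> simpa using h
  anticomm {i j x y} hx hy := by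
    rw [mul_sub_koszulOp_apply 𝒜 hx hy, mul_sub_koszulOp_apply 𝒜 hy hx, mul_comm j i]
    rcases Int.units_eq_one_or (i * j).negOnePow with h1 | h1 <;> rw [h1] <;> simp
  jacobi {i j k x y z} hx hy hz := by
    have hs : ∀ {i j : ℤ} {x y : A}, x ∈ 𝒜 i → y ∈ 𝒜 j →
        (LinearMap.mul F A - koszulOp 𝒜) x y ∈ 𝒜 (i + j) := by
      intro i j x y hx hy
      rw [mul_sub_koszulOp_apply 𝒜 hx hy]
      refine sub_mem (SetLike.mul_mem_graded hx hy) ?_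
      have h : y * x ∈ 𝒜 (i + j) := add_comm j i ▸ SetLike.mul_mem_graded hy hx
      rcases Int.units_eq_one_or (i * j).negOnePow with h1 | h1 <;> rw [h1] <;> simpa using h
    rw [mul_sub_koszulOp_apply 𝒜 hx (hs hy hz), mul_sub_koszulOp_apply 𝒜 (hs hx hy) hz,
      mul_sub_koszulOp_apply 𝒜 hy (hs hx hz), mul_sub_koszulOp_apply 𝒜 hy hz,
      mul_sub_koszulOp_apply 𝒜 hx hy, mul_sub_koszulOp_apply 𝒜 hx hz, mul_add, add_mul, mul_add,
      Int.negOnePow_add, Int.negOnePow_add, Int.negOnePow_add, mul_comm j i]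
    rcases Int.units_eq_one_or (i * j).negOnePow with h1 | h1 <;>
    rcases Int.units_eq_one_or (i * k).negOnePow with h2 | h2 <;>
    rcases Int.units_eq_one_or (j * k).negOnePow with h3 | h3 <;>
    simp only [h1, h2, h3, one_smul, mul_one, Units.neg_smul, neg_neg, mul_neg] <;>
    noncomm_ring

end Commutator

end GrLie

namespace GrSpace

variable {F : Type u} {E : Type v} [Field F] [AddCommGroup E] [Module F E] (V : GrSpace F E)

/-- The component of dimension `n` of the tensor algebra on a graded vector space: the span of
the products `v₁ ⋯ vₖ` of homogeneous vectors with `|v₁| + ⋯ + |vₖ| = n`. -/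
def tensorPart (n : ℤ) : Submodule F (TensorAlgebra F E) :=
  Submodule.span F {t | ∃ l : List (Σ d : ℤ, V.part d), (l.map Sigma.fst).sum = n ∧
    t = (l.map fun p => TensorAlgebra.ι F (p.2 : E)).prod}

instance tensorPart_gradedMonoid : SetLike.GradedMonoid V.tensorPart where
  one_mem := Submodule.subset_span ⟨[], by simp⟩
  mul_mem := by
    intro i j a b ha hb
    have h := Submodule.mul_mem_mul ha hb
    rw [tensorPart, tensorPart, Submodule.span_mul_span] at h
    refine Submodule.span_mono ?_ h
    rintro _ ⟨_, ⟨l, hl, rfl⟩, _, ⟨m, hm, rfl⟩, rfl⟩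
    exact ⟨l ++ m, by simp [hl, hm], by simp⟩

theorem ι_mem_tensorPart {n : ℤ} {v : E} (hv : v ∈ V.part n) :
    TensorAlgebra.ι F v ∈ V.tensorPart n :=
  Submodule.subset_span ⟨[⟨n, v, hv⟩], by simp⟩

/-- Auxiliary: the map splitting a vector of `E` into its homogeneous components in the tensor
algebra. -/
noncomputable def tensorSplitι : E →ₗ[F] ⨁ n, V.tensorPart n :=
  (DirectSum.toModule F ℤ _ fun n => DirectSum.lof F ℤ (fun n => V.tensorPart n) n ∘ₗ
    ((TensorAlgebra.ι F ∘ₗ (V.part n).subtype).codRestrict (V.tensorPart n)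
      fun v => V.ι_mem_tensorPart v.2)) ∘ₗ
    (LinearEquiv.ofBijective (DirectSum.coeLinearMap V.part) V.isInternal).symm.toLinearMap

theorem tensorSplitι_apply {n : ℤ} {v : E} (hv : v ∈ V.part n) :
    V.tensorSplitι v = DirectSum.of (fun n => V.tensorPart n) n
      ⟨TensorAlgebra.ι F v, V.ι_mem_tensorPart hv⟩ := by
  have h : (LinearEquiv.ofBijective (DirectSum.coeLinearMap V.part) V.isInternal).symm v =
      DirectSum.lof F ℤ (fun n => V.part n) n ⟨v, hv⟩ := by
    refine (LinearEquiv.symm_apply_eq _).2 ?_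
    exact (DirectSum.coeLinearMap_lof V.part n ⟨v, hv⟩).symm
  rw [tensorSplitι, LinearMap.comp_apply, LinearEquiv.coe_coe, h, DirectSum.toModule_lof]
  rfl

theorem coe_tensorSplit : (DirectSum.coeAlgHom V.tensorPart).comp
    (TensorAlgebra.lift F V.tensorSplitι) = AlgHom.id F _ := by
  refine TensorAlgebra.hom_ext (LinearMap.ext fun v => ?_)
  have hv : v ∈ ⨆ n, V.part n := V.iSup_part ▸ Submodule.mem_top
  simp only [LinearMap.comp_apply, AlgHom.toLinearMap_apply, AlgHom.comp_apply,
    TensorAlgebra.lift_ι_apply, AlgHom.id_apply]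
  refine Submodule.iSup_induction V.part (motive := fun v =>
    DirectSum.coeAlgHom V.tensorPart (V.tensorSplitι v) = TensorAlgebra.ι F v) hv ?_ ?_ ?_
  · intro n v hv
    rw [V.tensorSplitι_apply hv, DirectSum.coeAlgHom_of]
  · simp
  · intro a b ha hb
    simp [ha, hb]

theorem tensorSplit_mem {n : ℤ} {x : TensorAlgebra F E} (hx : x ∈ V.tensorPart n) :
    TensorAlgebra.lift F V.tensorSplitι x ∈
      LinearMap.range (DirectSum.lof F ℤ (fun n => V.tensorPart n) n) := by
  refine Submodule.span_le (p := (LinearMap.range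
    (DirectSum.lof F ℤ (fun n => V.tensorPart n) n)).comap
      (TensorAlgebra.lift F V.tensorSplitι).toLinearMap) |>.2 ?_ hx
  rintro _ ⟨l, rfl, rfl⟩
  clear hx
  induction l with
  | nil => exact ⟨GradedMonoid.GOne.one (A := fun n => V.tensorPart n), by simp; rfl⟩
  | cons p l ih =>
    obtain ⟨y, hy⟩ := ih
    refine ⟨GradedMonoid.GMul.mul (A := fun n => V.tensorPart n) ⟨_, V.ι_mem_tensorPart p.2.2⟩ y, ?_⟩
    simp only [AlgHom.toLinearMap_apply] at hy
    simp only [AlgHom.toLinearMap_apply, List.map_cons, List.prod_cons, map_mul, ← hy,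
      TensorAlgebra.lift_ι_apply, V.tensorSplitι_apply p.2.2, DirectSum.lof_eq_of]
    exact (DirectSum.of_mul_of _ _).symm

/-- The tensor algebra on a graded vector space is a graded algebra. -/
noncomputable instance tensorGradedAlgebra : GradedAlgebra V.tensorPart :=
  GradedAlgebra.ofAlgHom V.tensorPart (TensorAlgebra.lift F V.tensorSplitι)
    V.coe_tensorSplit
    (by
      intro n x
      obtain ⟨y, hy⟩ := V.tensorSplit_mem x.2
      have h := AlgHom.congr_fun V.coe_tensorSplit (x : TensorAlgebra F E)
      rw [AlgHom.comp_apply, ← hy] at h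
      have h' : (y : TensorAlgebra F E) = x := by simpa [DirectSum.lof_eq_of] using h
      rw [← hy, DirectSum.lof_eq_of, Subtype.ext h'])

/-- The tensor algebra on a graded vector space, as a graded Lie algebra under the graded
commutator. -/
noncomputable def tensorLie : GrLie F (TensorAlgebra F E) := GrLie.ofGradedAlgebra V.tensorPart

theorem isHomogeneous_range_ι :
    V.tensorLie.IsHomogeneous (LinearMap.range (TensorAlgebra.ι F (M := E))) := by
  rintro _ ⟨v, rfl⟩
  have hv : v ∈ ⨆ n, V.part n := V.iSup_part ▸ Submodule.mem_top
  refine Submodule.iSup_induction V.part (motive := fun v => TensorAlgebra.ι F v ∈ _) hv ?_ ?_ ?_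
  · intro n v hv
    exact Submodule.mem_iSup_of_mem n ⟨LinearMap.mem_range_self _ v, V.ι_mem_tensorPart hv⟩
  · simp
  · intro a b ha hb
    simpa using add_mem ha hb

/-- The underlying space of the free Lie algebra on a graded vector space `V`: the Lie subalgebra
of the tensor algebra generated by `V`. -/
noncomputable def freeLieSpace : Submodule F (TensorAlgebra F E) :=
  V.tensorLie.closure (LinearMap.range (TensorAlgebra.ι F))

/-- The free graded Lie algebra on a graded vector space. -/
noncomputable def freeLie : GrLie F V.freeLieSpace :=
  V.tensorLie.restrict V.freeLieSpace (V.tensorLie.isSubalgebra_closure _)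
    (V.tensorLie.isHomogeneous_closure _ V.isHomogeneous_range_ι)

/-- The inclusion of the generators into the free graded Lie algebra. -/
noncomputable def freeLieι : E →ₗ[F] V.freeLieSpace :=
  (TensorAlgebra.ι F).codRestrict V.freeLieSpace
    fun v => V.tensorLie.le_closure _ (LinearMap.mem_range_self _ v)

end GrSpace

/-- A graded Lie algebra is free if it is isomorphic, as a graded Lie algebra, to the free graded
Lie algebra on some graded vector space. -/
def GrLie.IsFree {F : Type u} {E : Type v} [Field F] [AddCommGroup E] [Module F E]
    (L : GrLie F E) : Prop :=
  ∃ (W : Type v) (_ : AddCommGroup W) (_ : Module F W) (V : GrSpace F W)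
    (f : GrLie.Hom V.freeLie L), Function.Bijective f.toLinearMap

/-- A bigraded Lie algebra: a graded Lie algebra (by dimension) with `E = ⨁ E_{i,j}`, where `i` is
the dimension and `j` the degree, whose bracket is additive in both. Signs only involve the
dimension. -/
structure BigrLie (F : Type u) (E : Type v) [Field F] [AddCommGroup E] [Module F E]
    extends GrLie F E where
  /-- `bipart i j` is the component of dimension `i` and degree `j`. -/
  bipart : ℤ → ℤ → Submodule F E
  isInternal_bipart : DirectSum.IsInternal fun p : ℤ × ℤ => bipart p.1 p.2
  part_eq : ∀ i, part i = ⨆ j, bipart i j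
  br_mem_bipart : ∀ {i j k l : ℤ} {x y : E}, x ∈ bipart i j → y ∈ bipart k l →
    br x y ∈ bipart (i + k) (j + l)

namespace BigrLie

variable {F : Type u} {E : Type v} [Field F] [AddCommGroup E] [Module F E] (L : BigrLie F E)

/-- The component `L_j` of degree `j`. -/
def degreePart (j : ℤ) : Submodule F E := ⨆ i, L.bipart i j

theorem isHomogeneous_degreePart (j : ℤ) : L.IsHomogeneous (L.degreePart j) :=
  iSup_mono fun i => le_inf (le_iSup (fun i => L.bipart i j) i)
    ((le_iSup (fun j => L.bipart i j) j).trans (L.part_eq i).ge)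

/-- The component `L_j` of degree `j`, graded by dimension. -/
def degreeSpace (j : ℤ) : GrSpace F (L.degreePart j) :=
  L.toGrSpace.restrict (L.degreePart j) (L.isHomogeneous_degreePart j)

/-- `L = L₀ ⋊ 𝕃L₁` as bigraded Lie algebras, where `L₀` and `L₁` are the components of degrees `0`
and `1`: the inclusion of `L₁` extends to an isomorphism of graded Lie algebras from the free
graded Lie algebra on `L₁` onto an ideal of `L` that is complementary to the Lie subalgebra `L₀`.
The bigrading forces `[L₀, L₁] ⊆ L₁`, so the action of `L₀` on `𝕃L₁` is the extension, by the
Jacobi identity, of an action of `L₀` on `L₁`. -/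
def IsSemidirectFree : Prop :=
  L.IsSubalgebra (L.degreePart 0) ∧
  ∃ f : GrLie.Hom (L.degreeSpace 1).freeLie L.toGrLie,
    (∀ v : L.degreePart 1, f.toLinearMap ((L.degreeSpace 1).freeLieι v) = v) ∧
    Function.Injective f.toLinearMap ∧
    L.IsIdeal (LinearMap.range f.toLinearMap) ∧
    IsCompl (L.degreePart 0) (LinearMap.range f.toLinearMap)

end BigrLie

/-!
Filter `L` by degree. Because `J` does not meet `L₀`, the top degree component of a nonzero element
of `J` has positive degree, hence lies in the free ideal `𝕃L₁`. The associated graded subalgebra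
`G` of `J` (`BigrLie.topFormSpace`) is therefore a bigraded subalgebra of `𝕃L₁`, which is free by a
graded version of the theorem of Shirshov and Witt. Lifting bihomogeneous free generators of `G` to
`J` gives a homomorphism from a free Lie algebra to `J` whose top degree part is the isomorphism
onto `G`, so that it is bijective itself (`BigrLie.bijective_of_top_degree`).

*Subalgebras of free Lie algebras.* Let `A` be the tensor algebra on `V = L₁`, with augmentation
ideal `A₊`. Call a graded subalgebra `K` of `𝕃V` tight if `K ∩ A₊K ⊆ [K, K]`. Left ideals of `A` are
free, so for tight `K` any family in `K` that is linearly independent modulo `[K, K]` is left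
independent over `A` (`GrSpace.IsTight.linearIndependent`), and hence generates a free associative
subalgebra, which contains the free Lie algebra on the family. It thus suffices that all graded
subalgebras are tight (`GrSpace.isTight_of_le_freeLieSpace`). `𝕃V` itself is tight. Tightness passes
from `K + F v` to an ideal `K` of codimension one, by Lazard elimination of `v`
(`GrSpace.isTight_of_sup_span`), where dividing by `2` is needed for odd `v`. In each finite range
of dimensions, every graded subalgebra is reached from `𝕃V` by finitely many such steps. No form of
the Poincaré-Birkhoff-Witt theorem is used.

*Homomorphisms from free Lie algebras.* A free Lie algebra is defined here inside a tensor algebra,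
so mapping it to `J` requires an embedding of `J` in an associative algebra. The Lie algebra `L`
acts on `A`, the module induced from the trivial module of `L₀` (`GrLie.FreeSemidirect.rho`):
`𝕃V` acts by left multiplication and `L₀` by derivations. The element `x` sends `1` to the component
of `x` in `𝕃V`, so this representation is faithful on `J`.
-/

/-! ### Graded spaces: gluing linear maps, components, graded subspaces -/

section Internal

variable {F : Type*} {E M κ : Type*} [Field F] [AddCommGroup E] [Module F E] [AddCommMonoid M]
  [Module F M] [DecidableEq κ] {G : κ → Submodule F E}

/-- The linear map on an internal direct sum that restricts to given maps on the summands. -/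
noncomputable def DirectSum.IsInternal.glue (h : IsInternal G) (φ : ∀ k, G k →ₗ[F] M) :
    E →ₗ[F] M :=
  DirectSum.toModule F κ M φ ∘ₗ
    (LinearEquiv.ofBijective (DirectSum.coeLinearMap G) h).symm.toLinearMap

theorem DirectSum.IsInternal.glue_apply (h : IsInternal G) (φ : ∀ k, G k →ₗ[F] M) {k : κ} {x : E}
    (hx : x ∈ G k) : h.glue φ x = φ k ⟨x, hx⟩ := by
  have h' : (LinearEquiv.ofBijective (DirectSum.coeLinearMap G) h).symm x =
      DirectSum.lof F κ (fun n => G n) k ⟨x, hx⟩ := by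
    refine (LinearEquiv.symm_apply_eq _).2 ?_
    exact (DirectSum.coeLinearMap_lof G k ⟨x, hx⟩).symm
  rw [glue, LinearMap.comp_apply, LinearEquiv.coe_coe, h', DirectSum.toModule_lof]

/-- A spanning family of subspaces is an internal direct sum as soon as it admits projections. -/
theorem DirectSum.isInternal_of_projections (p : κ → E →ₗ[F] E) (htop : ⨆ k, G k = ⊤)
    (hsame : ∀ k, ∀ x ∈ G k, p k x = x) (hne : ∀ k l, l ≠ k → ∀ x ∈ G l, p k x = 0) :
    IsInternal G := by
  refine isInternal_submodule_of_iSupIndep_of_iSup_eq_top (fun k => ?_) htop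
  rw [Submodule.disjoint_def]
  intro x hx hx'
  have h : (⨆ l, ⨆ _ : l ≠ k, G l) ≤ LinearMap.ker (p k) :=
    iSup₂_le fun l hl x hx => hne k l hl x hx
  rw [← hsame k x hx]
  exact h hx'

end Internal

namespace GrSpace

variable {F : Type*} {E M : Type*} [Field F] [AddCommGroup E] [Module F E] [AddCommMonoid M]
  [Module F M] (V : GrSpace F E)

theorem homogeneous_induction {p : E → Prop} (x : E) (hom : ∀ n, ∀ x ∈ V.part n, p x)
    (add : ∀ x y, p x → p y → p (x + y)) : p x := by
  have hx : x ∈ ⨆ n, V.part n := V.iSup_part ▸ Submodule.mem_top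
  exact Submodule.iSup_induction V.part (motive := p) hx hom (hom 0 0 (zero_mem _)) add

theorem linearMap_ext {f g : E →ₗ[F] M} (h : ∀ n, ∀ x ∈ V.part n, f x = g x) : f = g :=
  LinearMap.ext fun x => V.homogeneous_induction x h fun x y hx hy => by simp [hx, hy]

/-- The projection onto the component of dimension `n`. -/
noncomputable def proj (n : ℤ) : E →ₗ[F] E :=
  V.isInternal.glue fun k => if k = n then (V.part k).subtype else 0

variable {V}

theorem proj_of_mem {n : ℤ} {x : E} (hx : x ∈ V.part n) : V.proj n x = x := by
  simp [proj, V.isInternal.glue_apply _ hx]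

theorem proj_of_mem_ne {m n : ℤ} (hmn : m ≠ n) {x : E} (hx : x ∈ V.part m) :
    V.proj n x = 0 := by
  simp [proj, V.isInternal.glue_apply _ hx, hmn]

/-- Components of elements of a sum of homogeneous subspaces. -/
theorem proj_mem_of_mem_iSup {Q : ℤ → Submodule F E} (hQ : ∀ n, Q n ≤ V.part n) {x : E}
    (hx : x ∈ ⨆ n, Q n) (n : ℤ) : V.proj n x ∈ Q n := by
  refine Submodule.iSup_induction Q (motive := fun x => V.proj n x ∈ Q n) hx ?_ ?_ ?_
  · intro m x hx
    by_cases h : m = n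
    · subst h
      rwa [proj_of_mem (hQ m hx)]
    · rw [proj_of_mem_ne h (hQ m hx)]
      exact zero_mem _
  · simp
  · intro a b ha hb
    simpa using add_mem ha hb

theorem proj_mem (n : ℤ) (x : E) : V.proj n x ∈ V.part n :=
  proj_mem_of_mem_iSup (fun _ => le_rfl) (V.iSup_part ▸ Submodule.mem_top) n

theorem mem_of_mem_iSup_of_mem_part {Q : ℤ → Submodule F E} (hQ : ∀ n, Q n ≤ V.part n) {x : E}
    (hx : x ∈ ⨆ n, Q n) {n : ℤ} (hn : x ∈ V.part n) : x ∈ Q n :=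
  proj_of_mem hn ▸ proj_mem_of_mem_iSup hQ hx n

/-- An element lies in a subspace if all its components do. -/
theorem mem_of_proj_mem {W : Submodule F E} {x : E} (h : ∀ n, V.proj n x ∈ W) : x ∈ W := by
  have hx : x ∈ ⨆ n, V.part n := V.iSup_part ▸ Submodule.mem_top
  rw [Submodule.mem_iSup_iff_exists_finsupp] at hx
  obtain ⟨f, hf, rfl⟩ := hx
  refine Submodule.sum_mem _ fun i hi => ?_
  have := h i
  rwa [Finsupp.sum, map_sum, Finset.sum_eq_single i (fun j _ hj => proj_of_mem_ne hj (hf j))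
    (fun hi' => absurd hi hi'), proj_of_mem (hf i)] at this

theorem IsHomogeneous.proj_mem {W : Submodule F E} (hW : V.IsHomogeneous W) {x : E} (hx : x ∈ W)
    (n : ℤ) : V.proj n x ∈ W :=
  (proj_mem_of_mem_iSup (fun _ => inf_le_right) (hW hx) n).1

variable (V) in
/-- A subspace spanned by homogeneous elements is graded. -/
theorem isHomogeneous_span {s : Set E} (hs : ∀ x ∈ s, ∃ n, x ∈ V.part n) :
    V.IsHomogeneous (Submodule.span F s) :=
  Submodule.span_le.2 fun x hx => by
    obtain ⟨n, hn⟩ := hs x hx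
    exact Submodule.mem_iSup_of_mem n ⟨Submodule.subset_span hx, hn⟩

theorem IsHomogeneous.sup {W W' : Submodule F E} (hW : V.IsHomogeneous W)
    (hW' : V.IsHomogeneous W') : V.IsHomogeneous (W ⊔ W') :=
  sup_le (hW.trans (iSup_mono fun _ => inf_le_inf_right _ le_sup_left))
    (hW'.trans (iSup_mono fun _ => inf_le_inf_right _ le_sup_right))

theorem isHomogeneous_iSup {ι : Sort*} {W : ι → Submodule F E}
    (hW : ∀ i, V.IsHomogeneous (W i)) : V.IsHomogeneous (⨆ i, W i) :=
  iSup_le fun i => (hW i).trans (iSup_mono fun _ => inf_le_inf_right _ (le_iSup W i))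

theorem isHomogeneous_of_le_part {W : Submodule F E} {n : ℤ} (hW : W ≤ V.part n) :
    V.IsHomogeneous W := fun _ hx => Submodule.mem_iSup_of_mem n ⟨hx, hW hx⟩

/-- Induction over a graded subspace. -/
theorem IsHomogeneous.induction {W : Submodule F E} (hW : V.IsHomogeneous W) {p : E → Prop}
    {x : E} (hx : x ∈ W) (hom : ∀ n, ∀ x ∈ W, x ∈ V.part n → p x)
    (add : ∀ x y, p x → p y → p (x + y)) : p x :=
  Submodule.iSup_induction (fun n => W ⊓ V.part n) (motive := p) (hW hx)
    (fun n x hx => hom n x hx.1 hx.2) (hom 0 0 (zero_mem _) (zero_mem _)) add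

theorem IsHomogeneous.le_of_forall {W W' : Submodule F E} (hW : V.IsHomogeneous W)
    (h : ∀ n, ∀ x ∈ W, x ∈ V.part n → x ∈ W') : W ≤ W' :=
  fun _ hx => hW.induction hx h fun _ _ => add_mem

/-- A homogeneous element of the span of a set of homogeneous elements is a combination of
elements of the same dimension. -/
theorem mem_span_of_mem_part {s : Set E} (hs : ∀ x ∈ s, ∃ n, x ∈ V.part n) {n : ℤ} {x : E}
    (hx : x ∈ Submodule.span F s) (hn : x ∈ V.part n) :
    x ∈ Submodule.span F (s ∩ V.part n) := by
  refine mem_of_mem_iSup_of_mem_part (Q := fun n => Submodule.span F (s ∩ V.part n))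
    (fun n => Submodule.span_le.2 Set.inter_subset_right) ?_ hn
  refine Submodule.span_le.2 (fun y hy => ?_) hx
  obtain ⟨m, hm⟩ := hs y hy
  exact Submodule.mem_iSup_of_mem m (Submodule.subset_span ⟨hy, hm⟩)

end GrSpace

/-- A subset `t` of `s` that is a basis of the image of the span of `s` in the quotient by `D`. -/
theorem exists_family_linearIndependent_mod {F E : Type*} [Field F] [AddCommGroup E] [Module F E]
    (s : Set E) (D : Submodule F E) :
    ∃ t ⊆ s, Submodule.span F s ≤ D ⊔ Submodule.span F t ∧
      LinearIndependent F (D.mkQ ∘ ((↑) : t → E)) := by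
  obtain ⟨b, hbs, hspan, hb⟩ := exists_linearIndependent F (D.mkQ '' s)
  choose g hg hgq using fun x : b => hbs x.2
  refine ⟨Set.range g, by rintro _ ⟨x, rfl⟩; exact hg x, ?_, ?_⟩
  · have h1 : (Submodule.span F (Set.range g)).map D.mkQ = (Submodule.span F s).map D.mkQ := by
      rw [Submodule.map_span, Submodule.map_span, ← hspan, ← Set.range_comp]
      congr 1
      ext y
      simp only [Set.mem_range, Function.comp_apply, hgq]
      exact ⟨fun ⟨x, hx⟩ => hx ▸ x.2, fun hy => ⟨⟨y, hy⟩, rfl⟩⟩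
    have h2 := (Submodule.map_le_iff_le_comap.1 h1.ge)
    rwa [Submodule.comap_map_mkQ] at h2
  · have hinj : Function.Injective g := fun x y hxy =>
      Subtype.ext (by rw [← hgq x, ← hgq y, hxy])
    have h : (D.mkQ ∘ ((↑) : Set.range g → E)) ∘ Equiv.ofInjective g hinj =
        ((↑) : b → E ⧸ D) := funext hgq
    rw [← linearIndependent_equiv (Equiv.ofInjective g hinj), h]
    exact hb

/-! ### Tensor algebras -/

namespace TensorAlgebra

variable {F E : Type*} [Field F] [AddCommGroup E] [Module F E]

variable (F E) in
/-- The subspace of the tensor algebra spanned by the words with fewer than `N` letters. -/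
noncomputable def shortWords (N : ℕ) : Submodule F (TensorAlgebra F E) :=
  ∑ k ∈ Finset.range N, LinearMap.range (ι F : E →ₗ[F] _) ^ k

theorem shortWords_succ (N : ℕ) :
    shortWords F E (N + 1) = LinearMap.range (ι F) * shortWords F E N ⊔ 1 := by
  simp [shortWords, Finset.sum_range_succ', Finset.mul_sum, pow_succ']

theorem shortWords_succ' (N : ℕ) :
    shortWords F E (N + 1) = shortWords F E N * LinearMap.range (ι F) ⊔ 1 := by
  simp [shortWords, Finset.sum_range_succ', Finset.sum_mul, pow_succ]

theorem shortWords_mono : Monotone (shortWords F E) := fun _ _ h =>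
  Finset.sum_le_sum_of_subset (Finset.range_mono h)

theorem exists_mem_shortWords (x : TensorAlgebra F E) : ∃ N, x ∈ shortWords F E N := by
  have hx : x ∈ ⨆ k, LinearMap.range (ι F : E →ₗ[F] _) ^ k := by
    rw [(Decomposition.isInternal (fun k : ℕ =>
      LinearMap.range (ι F : E →ₗ[F] _) ^ k)).submodule_iSup_eq_top]
    trivial
  refine Submodule.iSup_induction _ (motive := fun x => ∃ N, x ∈ shortWords F E N) hx ?_ ?_ ?_
  · intro k x hx
    refine ⟨k + 1, ?_⟩
    rw [shortWords, Finset.sum_range_succ]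
    exact Submodule.mem_sup_right hx
  · exact ⟨0, zero_mem _⟩
  · rintro x y ⟨M, hM⟩ ⟨N, hN⟩
    exact ⟨max M N, add_mem (shortWords_mono (le_max_left M N) hM)
      (shortWords_mono (le_max_right M N) hN)⟩

/-- The algebra map `x ↦ (ε x, ∂x; 0, x)`, where `ε` is the augmentation and `∂` the map with
`∂ v = φ v` on generators and `∂(xy) = ∂x y + ε(x) ∂y`. Encoding `∂` by matrices gives it from the
universal property of the tensor algebra. -/
noncomputable def letterDerivMatrix (φ : E →ₗ[F] F) :
    TensorAlgebra F E →ₐ[F] Matrix (Fin 2) (Fin 2) (TensorAlgebra F E) :=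
  lift F
    { toFun := fun v => !![0, φ v • 1; 0, ι F v]
      map_add' := fun v w => by ext i j; fin_cases i <;> fin_cases j <;> simp [add_smul]
      map_smul' := fun c v => by ext i j; fin_cases i <;> fin_cases j <;> simp [mul_smul] }

theorem letterDerivMatrix_apply (φ : E →ₗ[F] F) (x : TensorAlgebra F E) :
    letterDerivMatrix φ x 1 0 = 0 ∧ letterDerivMatrix φ x 1 1 = x ∧
      letterDerivMatrix φ x 0 0 = algebraMap F _ (algebraMapInv x) := by
  induction x using TensorAlgebra.induction with
  | algebraMap r => simp [Matrix.algebraMap_matrix_apply]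
  | ι v => simp [letterDerivMatrix, algebraMapInv]
  | mul a b ha hb => simp [Matrix.mul_apply, ha, hb]
  | add a b ha hb => simp [ha, hb]

/-- Removal of the first letter `v` of a word `v x`, weighted by `φ v`. -/
noncomputable def letterDeriv (φ : E →ₗ[F] F) : TensorAlgebra F E →ₗ[F] TensorAlgebra F E where
  toFun x := letterDerivMatrix φ x 0 1
  map_add' x y := by simp
  map_smul' c x := by simp

theorem letterDeriv_mul_apply (φ : E →ₗ[F] F) (x y : TensorAlgebra F E) :
    letterDeriv φ (x * y) = letterDeriv φ x * y + (algebraMapInv x : F) • letterDeriv φ y := by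
  simp [letterDeriv, Matrix.mul_apply, letterDerivMatrix_apply φ x, letterDerivMatrix_apply φ y,
    Algebra.smul_def, add_comm]

theorem letterDeriv_ι (φ : E →ₗ[F] F) (v : E) : letterDeriv φ (ι F v) = φ v • 1 := by
  simp [letterDeriv, letterDerivMatrix]

theorem letterDeriv_ι_mul (φ : E →ₗ[F] F) (v : E) (x : TensorAlgebra F E) :
    letterDeriv φ (ι F v * x) = φ v • x := by
  simp [letterDeriv_mul_apply, letterDeriv_ι, algebraMapInv]

theorem letterDeriv_mem {φ : E →ₗ[F] F} {S : Submodule F (TensorAlgebra F E)}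
    {x : TensorAlgebra F E} (hx : x ∈ LinearMap.range (ι F) * S) : letterDeriv φ x ∈ S := by
  refine Submodule.mul_induction_on hx ?_ fun x y hx hy => by simpa using add_mem hx hy
  rintro _ ⟨v, rfl⟩ y hy
  rw [letterDeriv_ι_mul]
  exact S.smul_mem _ hy

theorem letterDeriv_mul {φ : E →ₗ[F] F} {S : Submodule F (TensorAlgebra F E)}
    {x : TensorAlgebra F E} (hx : x ∈ LinearMap.range (ι F) * S) (y : TensorAlgebra F E) :
    letterDeriv φ (x * y) = letterDeriv φ x * y := by
  refine Submodule.mul_induction_on hx ?_ fun x x' hx hx' => by simp [add_mul, hx, hx']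
  rintro _ ⟨v, rfl⟩ z hz
  rw [mul_assoc, letterDeriv_ι_mul, letterDeriv_ι_mul, smul_mul_assoc]

theorem exists_eq_sum_ι_mul {I : Type*} (b : Module.Basis I F E)
    {S : Submodule F (TensorAlgebra F E)} {x : TensorAlgebra F E}
    (hx : x ∈ LinearMap.range (ι F) * S) :
    ∃ g : I →₀ TensorAlgebra F E, x = g.sum fun j a => ι F (b j) * a := by
  refine Submodule.mul_induction_on hx ?_ ?_
  · rintro _ ⟨v, rfl⟩ y hy
    refine ⟨(b.repr v).mapRange (· • y) (zero_smul F y), ?_⟩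
    rw [Finsupp.sum_mapRange_index (by simp)]
    conv_lhs => rw [← b.linearCombination_repr v, Finsupp.linearCombination_apply]
    simp [Finsupp.sum, Finset.sum_mul]
  · rintro x y ⟨f, rfl⟩ ⟨g, rfl⟩
    exact ⟨f + g, (Finsupp.sum_add_index' (by simp) (by simp [mul_add])).symm⟩

theorem exists_eq_sum_mul_ι {I : Type*} (b : Module.Basis I F E)
    {S : Submodule F (TensorAlgebra F E)} {x : TensorAlgebra F E}
    (hx : x ∈ S * LinearMap.range (ι F)) :
    ∃ g : I →₀ TensorAlgebra F E, (∀ j, g j ∈ S) ∧ x = g.sum fun j a => a * ι F (b j) := by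
  refine Submodule.mul_induction_on hx ?_ ?_
  · rintro y hy _ ⟨v, rfl⟩
    refine ⟨(b.repr v).mapRange (· • y) (zero_smul F y), fun j => ?_, ?_⟩
    · exact S.smul_mem _ hy
    rw [Finsupp.sum_mapRange_index (by simp)]
    conv_lhs => rw [← b.linearCombination_repr v, Finsupp.linearCombination_apply]
    simp [Finsupp.sum, Finset.mul_sum]
  · rintro x y ⟨f, hf, rfl⟩ ⟨g, hg, rfl⟩
    exact ⟨f + g, fun j => add_mem (hf j) (hg j),
      (Finsupp.sum_add_index' (by simp) (by simp [add_mul])).symm⟩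

theorem eq_zero_of_letterDeriv_eq_zero {S : Submodule F (TensorAlgebra F E)}
    {x : TensorAlgebra F E} (hx : x ∈ LinearMap.range (ι F) * S)
    (h : ∀ φ : E →ₗ[F] F, letterDeriv φ x = 0) : x = 0 := by
  classical
  let b := Module.Basis.ofVectorSpace F E
  obtain ⟨g, rfl⟩ := exists_eq_sum_ι_mul b hx
  suffices hg : g = 0 by simp [hg]
  ext j
  have := h (b.coord j)
  rw [Finsupp.sum, map_sum] at this
  simp only [letterDeriv_ι_mul, Module.Basis.coord_apply, Module.Basis.repr_self,
    Finsupp.single_apply, ite_smul, one_smul, zero_smul] at this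
  simpa using this

theorem algebraMapInv_eq_zero_of_mem {S : Submodule F (TensorAlgebra F E)}
    {x : TensorAlgebra F E} (hx : x ∈ LinearMap.range (ι F) * S) :
    (algebraMapInv x : F) = 0 := by
  refine Submodule.mul_induction_on hx ?_ fun x x' hx hx' => by simp [hx, hx']
  rintro _ ⟨v, rfl⟩ z hz
  simp [algebraMapInv]

/-- Left ideals of the tensor algebra are free: a family `w` that generates a left ideal `I`
minimally, in the sense that it is linearly independent over `F` modulo the product of the
augmentation ideal with `I`, is linearly independent over the tensor algebra. A relation
`∑ aᵢ wᵢ = 0` has coefficients without constant term by minimality, so that removing the first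
letter of all `aᵢ` yields shorter relations. -/
theorem linearIndependent_of_indecomposable {I : Type*} (w : I → TensorAlgebra F E)
    (hw : ∀ c : I →₀ F, Finsupp.linearCombination F w c ∈
      LinearMap.ker (algebraMapInv : TensorAlgebra F E →ₐ[F] F).toLinearMap *
        Submodule.span F (Set.range w) → c = 0) :
    LinearIndependent (TensorAlgebra F E) w := by
  rw [linearIndependent_iff]
  suffices H : ∀ (N : ℕ) (a : I →₀ TensorAlgebra F E), (∀ i, a i ∈ shortWords F E N) →
      Finsupp.linearCombination (TensorAlgebra F E) w a = 0 → a = 0 by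
    intro a
    choose N hN using fun i => exists_mem_shortWords (a i)
    refine H (a.support.sup N) a fun i => ?_
    by_cases hi : i ∈ a.support
    · exact shortWords_mono (Finset.le_sup hi) (hN i)
    · simp [Finsupp.notMem_support_iff.1 hi]
  intro N
  induction N with
  | zero =>
    intro a ha _
    ext i
    simpa [shortWords] using ha i
  | succ N ih =>
    intro a ha h0
    let ε : TensorAlgebra F E →ₐ[F] F := algebraMapInv
    -- the constant terms of the coefficients vanish
    have hc : a.mapRange ε (map_zero ε) = 0 := by
      apply hw
      have h1 : Finsupp.linearCombination F w (a.mapRange ε (map_zero ε)) =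
          - ∑ i ∈ a.support, (a i - algebraMap F _ (ε (a i))) * w i := by
        rw [Finsupp.linearCombination_apply] at h0
        simp only [sub_mul, Finset.sum_sub_distrib, neg_sub]
        have h2 : ∑ i ∈ a.support, a i * w i = 0 := h0
        rw [h2, sub_zero, Finsupp.linearCombination_apply,
          Finsupp.sum_mapRange_index (by simp)]
        simp [Finsupp.sum, Algebra.smul_def]
      rw [h1]
      refine neg_mem (Submodule.sum_mem _ fun i _ => Submodule.mul_mem_mul ?_
        (Submodule.subset_span ⟨i, rfl⟩))
      have := algebraMap_leftInverse E (ε (a i))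
      simp only [LinearMap.mem_ker, AlgHom.toLinearMap_apply, map_sub]
      exact sub_eq_zero.2 this.symm
    have hmem : ∀ i, a i ∈ LinearMap.range (ι F) * shortWords F E N := by
      intro i
      have h1 := ha i
      rw [shortWords_succ] at h1
      obtain ⟨y, hy, z, hz, hyz⟩ := Submodule.mem_sup.1 h1
      obtain ⟨r, rfl⟩ := Submodule.mem_one.1 hz
      have h2 : ε (a i) = 0 := by simpa using DFunLike.congr_fun hc i
      have h3 : ε (algebraMap F _ r) = r := algebraMap_leftInverse E r
      rw [← hyz, map_add, algebraMapInv_eq_zero_of_mem hy, zero_add, h3] at h2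
      rw [← hyz, h2, map_zero, add_zero]
      exact hy
    ext i
    refine eq_zero_of_letterDeriv_eq_zero (hmem i) fun φ => ?_
    have h1 : a.mapRange (letterDeriv φ) (map_zero _) = 0 := by
      refine ih _ (fun i => by simpa using letterDeriv_mem (hmem i)) ?_
      have h2 := congrArg (letterDeriv φ) h0
      rw [Finsupp.linearCombination_apply, Finsupp.sum, map_sum, map_zero] at h2
      rw [Finsupp.linearCombination_apply, Finsupp.sum_mapRange_index (by simp), Finsupp.sum,
        ← h2]
      exact Finset.sum_congr rfl fun i _ => (letterDeriv_mul (hmem i) _).symm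
    simpa using DFunLike.congr_fun h1 i

/-- Elements of the augmentation ideal of an algebra `A` that are left independent over `A`
generate a free associative subalgebra. -/
theorem lift_injective_of_linearIndependent {A I : Type*} [Ring A] [Algebra F A]
    (ε : A →ₐ[F] F) (b : Module.Basis I F E) (h : E →ₗ[F] A) (hε : ∀ x, ε (h x) = 0)
    (hli : LinearIndependent A fun i => h (b i)) : Function.Injective (lift F h) := by
  rw [injective_iff_map_eq_zero]
  suffices H : ∀ N, ∀ x ∈ shortWords F E N, lift F h x = 0 → x = 0 by
    intro x
    obtain ⟨N, hN⟩ := exists_mem_shortWords x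
    exact H N x hN
  intro N
  induction N with
  | zero =>
    intro x hx _
    simpa [shortWords] using hx
  | succ N ih =>
    intro x hx h0
    rw [shortWords_succ'] at hx
    obtain ⟨y, hy, z, hz, rfl⟩ := Submodule.mem_sup.1 hx
    obtain ⟨r, rfl⟩ := Submodule.mem_one.1 hz
    obtain ⟨g, hg, rfl⟩ := exists_eq_sum_mul_ι b hy
    have h1 : lift F h (g.sum fun j a => a * ι F (b j)) =
        ∑ j ∈ g.support, lift F h (g j) * h (b j) := by
      simp [Finsupp.sum]
    have hr : r = 0 := by
      have := congrArg ε h0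
      rw [map_add, h1] at this
      simpa [hε] using this
    subst hr
    rw [map_zero, add_zero] at h0 ⊢
    have h2 : g.mapRange (lift F h) (map_zero _) = 0 := by
      refine linearIndependent_iff.1 hli _ ?_
      rw [Finsupp.linearCombination_apply, Finsupp.sum_mapRange_index (by simp), ← h0, h1]
      rfl
    have h3 : g = 0 := by
      ext j
      exact ih _ (hg j) (by simpa using DFunLike.congr_fun h2 j)
    simp [h3]

end TensorAlgebra

/-! ### Left independent families -/

section Independence

variable {A I P : Type*} [Ring A]

theorem LinearIndependent.eq_zero_of_option {w : I → A} {v : A}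
    (h : LinearIndependent A fun o : Option I => o.elim v w) {a : I →₀ A} {b : A}
    (hab : Finsupp.linearCombination A w a + b * v = 0) : a = 0 ∧ b = 0 := by
  have hinj : Function.Injective (some : I → Option I) := Option.some_injective I
  have h0 : a.mapDomain some + Finsupp.single none b = 0 := by
    refine linearIndependent_iff.1 h _ ?_
    rw [map_add, Finsupp.linearCombination_mapDomain, Finsupp.linearCombination_single, ← hab]
    rfl
  constructor
  · ext i
    have := DFunLike.congr_fun h0 (some i)
    simpa [Finsupp.mapDomain_apply hinj] using this
  · have := DFunLike.congr_fun h0 none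
    simpa [Finsupp.mapDomain_of_notMem_range] using this

/-- If `w` and `v` are left independent and so is `y`, then so are `w` and `y v`. -/
theorem LinearIndependent.sum_elim_mul {w : I → A} {v : A}
    (h : LinearIndependent A fun o : Option I => o.elim v w) {y : P → A}
    (hy : LinearIndependent A y) :
    LinearIndependent A (Sum.elim w fun p => y p * v) := by
  rw [linearIndependent_iff]
  intro a ha
  rw [← Finsupp.comapDomain_sumElim_comapDomain a] at ha ⊢
  generalize Finsupp.comapDomain Sum.inl a _ = b at ha ⊢
  generalize Finsupp.comapDomain Sum.inr a _ = c at ha ⊢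
  have h1 : Finsupp.linearCombination A w b + Finsupp.linearCombination A y c * v = 0 := by
    rw [← ha, Finsupp.sumElim_eq_add, map_add, Finsupp.linearCombination_mapDomain,
      Finsupp.linearCombination_mapDomain]
    simp [Finsupp.linearCombination_apply, Finsupp.sum, Finset.sum_mul, mul_assoc]
  obtain ⟨rfl, h2⟩ := h.eq_zero_of_option h1
  rw [linearIndependent_iff.1 hy c h2, Finsupp.sumElim_zero_zero]

/-- If `w` and `v` are left independent, then so are the products `w vᵏ`. -/
theorem LinearIndependent.mul_pow {w : I → A} {v : A}
    (h : LinearIndependent A fun o : Option I => o.elim v w) :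
    LinearIndependent A fun p : ℕ × I => w p.2 * v ^ p.1 := by
  have H : ∀ (N : ℕ) (a : ℕ → I →₀ A),
      ∑ k ∈ Finset.range N, Finsupp.linearCombination A w (a k) * v ^ k = 0 →
        ∀ k < N, a k = 0 := by
    intro N
    induction N with
    | zero => simp
    | succ N ih =>
      intro a ha k hk
      rw [Finset.sum_range_succ', pow_zero, mul_one, add_comm] at ha
      simp only [pow_succ, ← mul_assoc] at ha
      rw [← Finset.sum_mul] at ha
      obtain ⟨h0, h1⟩ := h.eq_zero_of_option ha
      cases k with
      | zero => exact h0
      | succ k => exact ih (fun k => a (k + 1)) h1 k (by omega)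
  rw [linearIndependent_iff]
  intro a ha
  rw [← Finsupp.uncurry_curry a] at ha ⊢
  generalize a.curry = a at ha ⊢
  have h0 : a = 0 := by
    ext1 k
    by_cases hk : k ∈ a.support
    · refine H (a.support.sup id + 1) a ?_ k (Nat.lt_succ_of_le (Finset.le_sup (f := id) hk))
      rw [← ha, Finsupp.linearCombination_apply, Finsupp.sum_uncurry_index]
      refine (Finset.sum_subset (fun k hk => Finset.mem_range.2
        (Nat.lt_succ_of_le (Finset.le_sup (f := id) hk))) fun k _ hk => ?_).symm.trans ?_
      · simp [Finsupp.notMem_support_iff.1 hk]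
      · refine Finset.sum_congr rfl fun k _ => ?_
        simp [Finsupp.linearCombination_apply, Finsupp.sum, Finset.sum_mul, mul_assoc]
    · simpa using hk
  rw [h0]
  rfl

end Independence

/-! ### Graded subalgebras and brackets -/

namespace GrSpace

variable {F : Type*} {E : Type*} [Field F] [AddCommGroup E] [Module F E] {V : GrSpace F E}

theorem eq_of_mem_part {m n : ℤ} {x : E} (hx : x ≠ 0) (hm : x ∈ V.part m) (hn : x ∈ V.part n) :
    m = n := by
  by_contra h
  exact hx (by rw [← proj_of_mem hn, proj_of_mem_ne h hm])

/-- Induction on dimension: a graded subspace `K` in positive dimensions, spanned by homogeneous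
elements `s`, lies in `T` if each element of `s` lies in `T` provided that `T` contains `K` in lower
dimensions. -/
theorem IsHomogeneous.le_of_generators {K T : Submodule F E} {s : Set E}
    (hpos : ∀ n ≤ 0, K ⊓ V.part n = ⊥) (hK : V.IsHomogeneous K)
    (hs : ∀ x ∈ s, ∃ n, x ∈ V.part n) (hKs : K ≤ Submodule.span F s)
    (h : ∀ n, (∀ m < n, K ⊓ V.part m ≤ T) → ∀ x ∈ s, x ∈ V.part n → x ∈ T) : K ≤ T := by
  have H : ∀ (N : ℕ) (n : ℤ), n < N → K ⊓ V.part n ≤ T := by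
    intro N
    induction N with
    | zero =>
      intro n hn
      rw [hpos n (by push_cast at hn; omega)]
      exact bot_le
    | succ N ih =>
      rintro n hn x ⟨hxK, hxn⟩
      have hx := mem_span_of_mem_part hs (hKs hxK) hxn
      refine Submodule.span_le.2 (fun y hy => ?_) hx
      exact h n (fun m hm => ih m (by push_cast at hn; omega)) y hy.1 hy.2
  exact hK.le_of_forall fun n x hx hn => H (n.toNat + 1) n (by push_cast; omega) ⟨hx, hn⟩

end GrSpace

namespace GrLie

variable {F : Type*} {E : Type*} [Field F] [AddCommGroup E] [Module F E] (L : GrLie F E)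

/-- The span of the brackets of elements of `K`. -/
def derived (K : Submodule F E) : Submodule F E := Submodule.map₂ L.br K K

variable {L} {K K' T : Submodule F E}

theorem br_mem_derived {x y : E} (hx : x ∈ K) (hy : y ∈ K) : L.br x y ∈ L.derived K :=
  Submodule.apply_mem_map₂ _ hx hy

theorem IsSubalgebra.derived_le (hK : L.IsSubalgebra K) : L.derived K ≤ K :=
  Submodule.map₂_le.2 hK

theorem br_mem_of_homogeneous (hK : L.IsHomogeneous K) (hK' : L.IsHomogeneous K')
    (h : ∀ i j, ∀ a ∈ K, a ∈ L.part i → ∀ b ∈ K', b ∈ L.part j → L.br a b ∈ T) :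
    ∀ a ∈ K, ∀ b ∈ K', L.br a b ∈ T := by
  intro a ha b hb
  refine hK.induction (p := fun a => L.br a b ∈ T) ha (fun i a ha hai => ?_) fun x y hx hy => ?_
  · refine hK'.induction (p := fun b => L.br a b ∈ T) hb (fun j b hb hbj => h i j a ha hai b hb hbj)
      fun x y hx hy => ?_
    simpa using add_mem hx hy
  · simpa using add_mem hx hy

theorem derived_le_of_homogeneous (hK : L.IsHomogeneous K)
    (h : ∀ i j, ∀ a ∈ K, a ∈ L.part i → ∀ b ∈ K, b ∈ L.part j → L.br a b ∈ T) :
    L.derived K ≤ T := Submodule.map₂_le.2 (br_mem_of_homogeneous hK hK h)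

variable (L) in
/-- The brackets of homogeneous elements of `K`. -/
def homogeneousBrackets (K : Submodule F E) : Set E :=
  {x | ∃ i j, ∃ a ∈ K, a ∈ L.part i ∧ ∃ b ∈ K, b ∈ L.part j ∧ x = L.br a b}

theorem homogeneousBrackets_homogeneous {x : E} (hx : x ∈ L.homogeneousBrackets K) :
    ∃ n, x ∈ L.part n := by
  obtain ⟨i, j, a, -, hai, b, -, hbj, rfl⟩ := hx
  exact ⟨i + j, L.br_mem hai hbj⟩

theorem derived_eq_span (hK : L.IsHomogeneous K) :
    L.derived K = Submodule.span F (L.homogeneousBrackets K) := by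
  refine le_antisymm (derived_le_of_homogeneous hK fun i j a ha hai b hb hbj =>
    Submodule.subset_span ⟨i, j, a, ha, hai, b, hb, hbj, rfl⟩) (Submodule.span_le.2 ?_)
  rintro _ ⟨i, j, a, ha, -, b, hb, -, rfl⟩
  exact br_mem_derived ha hb

theorem isHomogeneous_derived (hK : L.IsHomogeneous K) : L.IsHomogeneous (L.derived K) :=
  derived_eq_span hK ▸ L.isHomogeneous_span fun _ => homogeneousBrackets_homogeneous

theorem units_smul_mem_iff (u : ℤˣ) {x : E} : u • x ∈ T ↔ x ∈ T := by
  rcases Int.units_eq_one_or u with rfl | rfl <;> simp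

theorem br_swap_mem {i j : ℤ} {x y : E} (hx : x ∈ L.part i) (hy : y ∈ L.part j)
    (h : L.br x y ∈ T) : L.br y x ∈ T := by
  rw [L.anticomm hy hx]
  exact neg_mem ((units_smul_mem_iff _).2 h)

/-- A bracket that lies in dimension `n`, of elements of a graded subspace in positive dimensions,
is zero or has arguments of dimensions less than `n` adding up to `n`. -/
theorem lt_of_br_mem_part (hpos : ∀ n ≤ 0, K ⊓ L.part n = ⊥) {i j n : ℤ} {a b : E}
    (ha : a ∈ K) (hai : a ∈ L.part i) (hb : b ∈ K) (hbj : b ∈ L.part j)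
    (hn : L.br a b ∈ L.part n) (h0 : L.br a b ≠ 0) : i < n ∧ j < n ∧ i + j = n := by
  have hij := GrSpace.eq_of_mem_part h0 (L.br_mem hai hbj) hn
  have hi : 0 < i := by
    by_contra hi
    have : a ∈ K ⊓ L.part i := ⟨ha, hai⟩
    rw [hpos i (not_lt.1 hi), Submodule.mem_bot] at this
    simp [this] at h0
  have hj : 0 < j := by
    by_contra hj
    have : b ∈ K ⊓ L.part j := ⟨hb, hbj⟩
    rw [hpos j (not_lt.1 hj), Submodule.mem_bot] at this
    simp [this] at h0
  omega

/-- A graded subspace in positive dimensions lies in `T` if it is spanned by homogeneous elements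
of `T` together with its own brackets, and brackets of elements in `K ⊓ T` are in `T`. -/
theorem le_of_le_derived_sup_span {s : Set E} (hpos : ∀ n ≤ 0, K ⊓ L.part n = ⊥)
    (hK : L.IsHomogeneous K) (hs : ∀ x ∈ s, ∃ n, x ∈ L.part n)
    (hKs : K ≤ L.derived K ⊔ Submodule.span F s) (hsT : ∀ x ∈ s, x ∈ T)
    (h : ∀ i j, ∀ a ∈ K ⊓ T, a ∈ L.part i → ∀ b ∈ K ⊓ T, b ∈ L.part j → L.br a b ∈ T) :
    K ≤ T := by
  rw [derived_eq_span hK, ← Submodule.span_union] at hKs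
  refine hK.le_of_generators hpos ?_ hKs fun n hn x hx hxn => ?_
  · rintro x (hx | hx)
    · exact homogeneousBrackets_homogeneous hx
    · exact hs x hx
  · rcases hx with ⟨i, j, a, ha, hai, b, hb, hbj, rfl⟩ | hx
    · by_cases h0 : L.br a b = 0
      · rw [h0]
        exact zero_mem _
      · obtain ⟨hi, hj, -⟩ := lt_of_br_mem_part hpos ha hai hb hbj hxn h0
        exact h i j a ⟨ha, hn i hi ⟨ha, hai⟩⟩ hai b ⟨hb, hn j hj ⟨hb, hbj⟩⟩ hbj
    · exact hsT x hx

end GrLie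

/-- Homogeneous elements of a graded subspace `K` that span `K` modulo `D` and are linearly
independent modulo `D`. -/
theorem GrSpace.IsHomogeneous.exists_family {F : Type*} {E : Type*} [Field F] [AddCommGroup E]
    [Module F E] {V : GrSpace F E} {K : Submodule F E} (hK : V.IsHomogeneous K)
    (D : Submodule F E) :
    ∃ t : Set E, (∀ x ∈ t, x ∈ K) ∧ (∀ x ∈ t, ∃ n, x ∈ V.part n) ∧
      K ≤ D ⊔ Submodule.span F t ∧
      ∀ c : t →₀ F, Finsupp.linearCombination F ((↑) : t → E) c ∈ D → c = 0 := by
  obtain ⟨t, ht, hKt, hli⟩ :=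
    exists_family_linearIndependent_mod (F := F) {x | x ∈ K ∧ ∃ n, x ∈ V.part n} D
  refine ⟨t, fun x hx => (ht hx).1, fun x hx => (ht hx).2, le_trans ?_ hKt, fun c hc => ?_⟩
  · exact hK.le_of_forall fun n x hx hn => Submodule.subset_span ⟨hx, n, hn⟩
  · refine linearIndependent_iff.1 hli c ?_
    rw [← Finsupp.apply_linearCombination]
    simpa using hc

/-! ### Tight subalgebras of the tensor algebra -/

namespace GrSpace

open TensorAlgebra

variable {F : Type*} {E : Type*} [Field F] [AddCommGroup E] [Module F E] (V : GrSpace F E)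

theorem tensorLie_br_apply {i j : ℤ} {x y : TensorAlgebra F E} (hx : x ∈ V.tensorLie.part i)
    (hy : y ∈ V.tensorLie.part j) :
    V.tensorLie.br x y = x * y - (i * j).negOnePow • (y * x) :=
  GrLie.mul_sub_koszulOp_apply V.tensorPart hx hy

theorem mul_mem_tensorLie_part {V : GrSpace F E} {i j : ℤ} {x y : TensorAlgebra F E}
    (hx : x ∈ V.tensorLie.part i) (hy : y ∈ V.tensorLie.part j) :
    x * y ∈ V.tensorLie.part (i + j) := SetLike.mul_mem_graded (A := V.tensorPart) hx hy

theorem tensorLie_part (n : ℤ) : V.tensorLie.part n = V.tensorPart n := rfl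

variable (F E) in
/-- The augmentation ideal of the tensor algebra. -/
noncomputable def augIdeal : Submodule F (TensorAlgebra F E) :=
  LinearMap.ker (algebraMapInv : TensorAlgebra F E →ₐ[F] F).toLinearMap

theorem mem_augIdeal {x : TensorAlgebra F E} : x ∈ augIdeal F E ↔ algebraMapInv x = (0 : F) :=
  Iff.rfl

theorem mul_mem_augIdeal_left {x : TensorAlgebra F E} (hx : x ∈ augIdeal F E)
    (y : TensorAlgebra F E) : x * y ∈ augIdeal F E := by
  rw [mem_augIdeal] at *
  simp [hx]

theorem mul_mem_augIdeal_right {x : TensorAlgebra F E} (hx : x ∈ augIdeal F E)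
    (y : TensorAlgebra F E) : y * x ∈ augIdeal F E := by
  rw [mem_augIdeal] at *
  simp [hx]

variable {V} in
theorem tensorPart_inf_augIdeal (hV : V.IsConnected) {n : ℤ} (hn : n ≤ 0) :
    augIdeal F E ⊓ V.tensorLie.part n = ⊥ := by
  rw [tensorLie_part]
  have h1 : V.tensorPart n ≤ 1 := by
    refine Submodule.span_le.2 ?_
    rintro _ ⟨l, hl, rfl⟩
    rcases l with _ | ⟨p, l⟩
    · simp
    by_cases h : ∀ q ∈ p :: l, 0 < q.1
    · have h2 : 0 < ((p :: l).map Sigma.fst).sum := by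
        refine List.sum_pos _ ?_ (by simp)
        intro x hx
        obtain ⟨q, hq, rfl⟩ := List.mem_map.1 hx
        exact h q hq
      omega
    · push Not at h
      obtain ⟨q, hq, hq0⟩ := h
      have h2 : (q.2 : E) = 0 := (Submodule.mem_bot F).1 ((hV _ hq0).le q.2.2)
      have h3 : ((p :: l).map fun p => ι F (p.2 : E)).prod = 0 := by
        refine List.prod_eq_zero (List.mem_map.2 ⟨q, hq, ?_⟩)
        rw [h2, map_zero]
      rw [h3]
      exact zero_mem _
  rw [eq_bot_iff]
  rintro x ⟨hx, hxn⟩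
  obtain ⟨r, rfl⟩ := Submodule.mem_one.1 (h1 hxn)
  have h2 : r = 0 := (algebraMap_leftInverse E r).symm.trans hx
  simp [h2]

/-- A Lie subalgebra `K` of the tensor algebra is tight if its elements that lie in the product of
the augmentation ideal with `K` are sums of brackets of elements of `K`. This is what makes a
minimal generating set of `K` also minimal for the left ideal it generates. -/
def IsTight (K : Submodule F (TensorAlgebra F E)) : Prop :=
  K ⊓ augIdeal F E * K ≤ V.tensorLie.derived K

variable {V} {K : Submodule F (TensorAlgebra F E)}

theorem IsTight.linearIndependent (hK : V.IsTight K) {I : Type*} {w : I → TensorAlgebra F E}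
    (hwK : ∀ i, w i ∈ K)
    (hw : ∀ c : I →₀ F, Finsupp.linearCombination F w c ∈ V.tensorLie.derived K → c = 0) :
    LinearIndependent (TensorAlgebra F E) w := by
  have hle : Submodule.span F (Set.range w) ≤ K :=
    Submodule.span_le.2 (Set.range_subset_iff.2 hwK)
  refine linearIndependent_of_indecomposable w fun c hc => hw c (hK ⟨hle ?_, ?_⟩)
  · exact Finsupp.mem_span_range_iff_exists_finsupp.2 ⟨c, rfl⟩
  · exact mul_le_mul' le_rfl hle hc

theorem derived_le_augIdeal_mul (hKh : V.tensorLie.IsHomogeneous K) (hKε : K ≤ augIdeal F E) :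
    V.tensorLie.derived K ≤ augIdeal F E * K :=
  GrLie.derived_le_of_homogeneous hKh fun i j a ha hai b hb hbj => by
    rw [V.tensorLie_br_apply hai hbj]
    exact sub_mem (Submodule.mul_mem_mul (hKε ha) hb)
      ((GrLie.units_smul_mem_iff _).2 (Submodule.mul_mem_mul (hKε hb) ha))

/-- A criterion for tightness: `K` is spanned, modulo brackets, by homogeneous elements `z` that
agree with a left independent family `y` modulo the product of the augmentation ideal with the left
ideal generated by `y`. -/
theorem isTight_of_linearIndependent (hV : V.IsConnected) (hKh : V.tensorLie.IsHomogeneous K)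
    (hKε : K ≤ augIdeal F E) {P : Type*} {y z : P → TensorAlgebra F E}
    (hy : LinearIndependent (TensorAlgebra F E) y) (hz : ∀ p, ∃ n, z p ∈ V.tensorLie.part n)
    (hzy : ∀ p, z p - y p ∈ augIdeal F E *
      (Submodule.span (TensorAlgebra F E) (Set.range y)).restrictScalars F)
    (hKz : K ≤ V.tensorLie.derived K ⊔ Submodule.span F (Set.range z)) : V.IsTight K := by
  set U := (Submodule.span (TensorAlgebra F E) (Set.range y)).restrictScalars F with hU
  have hUmul : ∀ (a : TensorAlgebra F E), ∀ b ∈ U, a * b ∈ U := fun a b hb =>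
    Submodule.smul_mem (Submodule.span (TensorAlgebra F E) (Set.range y)) a hb
  have hUU : augIdeal F E * U ≤ U := Submodule.mul_le.2 fun a _ b hb => hUmul a b hb
  have hyU : ∀ p, y p ∈ U := fun p => Submodule.subset_span ⟨p, rfl⟩
  have hzU : ∀ p, z p ∈ U := fun p => by
    have := add_mem (hUU (hzy p)) (hyU p)
    rwa [sub_add_cancel] at this
  have hpos : ∀ n ≤ 0, K ⊓ V.tensorLie.part n = ⊥ := fun n hn =>
    eq_bot_iff.2 ((inf_le_inf_right _ hKε).trans (tensorPart_inf_augIdeal hV hn).le)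
  have hKU : K ≤ U := by
    refine GrLie.le_of_le_derived_sup_span hpos hKh ?_ hKz ?_ ?_
    · rintro _ ⟨p, rfl⟩
      exact hz p
    · rintro _ ⟨p, rfl⟩
      exact hzU p
    · intro i j a ha hai b hb hbj
      rw [V.tensorLie_br_apply hai hbj]
      exact sub_mem (hUmul _ _ hb.2) ((GrLie.units_smul_mem_iff _).2 (hUmul _ _ ha.2))
  -- every element of `augIdeal * U` is a combination of `y` with coefficients in the ideal
  have hεU : ∀ x ∈ augIdeal F E * U, ∃ a : P →₀ TensorAlgebra F E,
      (∀ p, a p ∈ augIdeal F E) ∧ Finsupp.linearCombination (TensorAlgebra F E) y a = x := by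
    intro x hx
    refine Submodule.mul_induction_on hx ?_ ?_
    · intro e he u hu
      obtain ⟨a, rfl⟩ := Finsupp.mem_span_range_iff_exists_finsupp.1 hu
      exact ⟨e • a, fun p => mul_mem_augIdeal_left he _, by simp [Finsupp.linearCombination_apply]⟩
    · rintro _ _ ⟨a, ha, rfl⟩ ⟨b, hb, rfl⟩
      exact ⟨a + b, fun p => add_mem (ha p) (hb p), map_add _ _ _⟩
  rintro u ⟨huK, hu⟩
  obtain ⟨d, hd, s, hs, rfl⟩ := Submodule.mem_sup.1 (hKz huK)
  obtain ⟨c, rfl⟩ := Finsupp.mem_span_range_iff_exists_finsupp.1 hs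
  have hmono : augIdeal F E * K ≤ augIdeal F E * U := mul_le_mul' le_rfl hKU
  have h1 : (c.sum fun p r => r • z p) ∈ augIdeal F E * U := by
    have := sub_mem (hmono hu) (hmono (derived_le_augIdeal_mul hKh hKε hd))
    rwa [add_sub_cancel_left] at this
  have h2 : (c.sum fun p r => r • y p) ∈ augIdeal F E * U := by
    have h3 : (c.sum fun p r => r • z p) - (c.sum fun p r => r • y p) =
        c.sum fun p r => r • (z p - y p) := by
      simp [Finsupp.sum, smul_sub]
    have h4 : (c.sum fun p r => r • (z p - y p)) ∈ augIdeal F E * U :=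
      Submodule.sum_mem _ fun p _ => Submodule.smul_mem _ _ (hzy p)
    have := sub_mem h1 h4
    rwa [← h3, sub_sub_cancel] at this
  obtain ⟨a, ha, hay⟩ := hεU _ h2
  have hc : c = 0 := by
    have h3 : c.mapRange (algebraMap F (TensorAlgebra F E)) (map_zero _) = a := by
      refine hy ?_
      rw [hay, Finsupp.linearCombination_apply, Finsupp.sum_mapRange_index (by simp)]
      simp [Algebra.smul_def]
    ext p
    have h4 := ha p
    rw [← h3, mem_augIdeal, Finsupp.mapRange_apply] at h4
    exact (algebraMap_leftInverse E (c p)).symm.trans h4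
  simpa [hc] using hd

end GrSpace

/-! ### Elimination of a generator -/

namespace GrLie

variable {F : Type*} {E : Type*} [Field F] [AddCommGroup E] [Module F E] {L : GrLie F E}
  {K : Submodule F E} {n : ℤ} {v : E}

/-- A derivation `[·, v]` of `K` preserves the span of the brackets. -/
theorem br_br_mem_derived (hK : L.IsHomogeneous K) (hv : v ∈ L.part n)
    (hvK : ∀ x ∈ K, L.br x v ∈ K) {x : E} (hx : x ∈ L.derived K) : L.br x v ∈ L.derived K := by
  have h : L.derived K ≤ (L.derived K).comap (L.br.flip v) := by
    refine derived_le_of_homogeneous hK fun i j a ha hai b hb hbj => ?_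
    have := L.jacobi hai hbj hv
    rw [Submodule.mem_comap, LinearMap.flip_apply, ← sub_eq_iff_eq_add.2 this]
    exact sub_mem (br_mem_derived ha (hvK b hb))
      ((units_smul_mem_iff _).2 (br_mem_derived hb (hvK a ha)))
  exact h hx

theorem derived_sup_span_le (hK : L.IsHomogeneous K) (hv : v ∈ L.part n) :
    L.derived (K ⊔ Submodule.span F {v}) ≤
      L.derived K ⊔ K.map (L.br.flip v) ⊔ Submodule.span F {L.br v v} := by
  have hswap : ∀ k ∈ K, L.br v k ∈ K.map (L.br.flip v) := by
    intro k hk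
    refine hK.induction (p := fun k => L.br v k ∈ K.map (L.br.flip v)) hk
      (fun m k hk hkm => ?_) fun x y hx hy => ?_
    · exact br_swap_mem hkm hv (Submodule.mem_map_of_mem hk)
    · simpa using add_mem hx hy
  refine Submodule.map₂_le.2 fun x hx y hy => ?_
  obtain ⟨a, ha, _, hc, rfl⟩ := Submodule.mem_sup.1 hx
  obtain ⟨c, rfl⟩ := Submodule.mem_span_singleton.1 hc
  obtain ⟨b, hb, _, hd, rfl⟩ := Submodule.mem_sup.1 hy
  obtain ⟨d, rfl⟩ := Submodule.mem_span_singleton.1 hd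
  simp only [map_add, LinearMap.add_apply, map_smul, LinearMap.smul_apply, smul_add]
  refine add_mem (add_mem ?_ ?_) (add_mem ?_ ?_)
  · exact Submodule.mem_sup_left (Submodule.mem_sup_left (br_mem_derived ha hb))
  · exact Submodule.smul_mem _ _ (Submodule.mem_sup_left (Submodule.mem_sup_right (hswap b hb)))
  · exact Submodule.smul_mem _ _ (Submodule.mem_sup_left (Submodule.mem_sup_right
      (Submodule.mem_map_of_mem (f := L.br.flip v) ha)))
  · exact Submodule.smul_mem _ _ (Submodule.smul_mem _ _ (Submodule.mem_sup_right
      (Submodule.mem_span_singleton_self _)))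

end GrLie

namespace GrSpace

open TensorAlgebra

variable {F : Type*} {E : Type*} [Field F] [AddCommGroup E] [Module F E] {V : GrSpace F E}
  {K : Submodule F (TensorAlgebra F E)} {n : ℤ} {v : TensorAlgebra F E}

theorem tensorLie_br_apply_of_even (hn : Even n) (hv : v ∈ V.tensorLie.part n)
    (x : TensorAlgebra F E) : V.tensorLie.br x v = x * v - v * x := by
  refine V.tensorLie.homogeneous_induction (p := fun x => V.tensorLie.br x v = x * v - v * x) x
    (fun m x hx => ?_) fun x y hx hy => ?_
  · rw [V.tensorLie_br_apply hx hv, Int.negOnePow_even _ (hn.mul_left m), one_smul]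
  · rw [map_add, LinearMap.add_apply, hx, hy]
    noncomm_ring

theorem tensorLie_br_self_of_odd (hn : Odd n) (hv : v ∈ V.tensorLie.part n) :
    V.tensorLie.br v v = (2 : F) • (v * v) := by
  rw [V.tensorLie_br_apply hv hv, Int.negOnePow_odd _ (hn.mul hn), Units.neg_smul, one_smul,
    two_smul, sub_neg_eq_add]

/-- For odd `v`, the square of the derivation `[·, v]` is the inner derivation of `v²`. -/
theorem tensorLie_br_br_of_odd (hn : Odd n) (hv : v ∈ V.tensorLie.part n) {m : ℤ}
    {x : TensorAlgebra F E} (hx : x ∈ V.tensorLie.part m) :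
    V.tensorLie.br (V.tensorLie.br x v) v = V.tensorLie.br x (v * v) := by
  have hvv : v * v ∈ V.tensorLie.part (n + n) := mul_mem_tensorLie_part hv hv
  rw [V.tensorLie_br_apply (V.tensorLie.br_mem hx hv) hv, V.tensorLie_br_apply hx hvv,
    V.tensorLie_br_apply hx hv, add_mul, Int.negOnePow_add, Int.negOnePow_odd _ (hn.mul hn),
    Int.negOnePow_even (m * (n + n)) ((Even.add_self n).mul_left m)]
  rcases Int.units_eq_one_or (m * n).negOnePow with h | h <;>
    simp only [h, one_smul, Units.neg_smul, mul_neg, mul_one, neg_neg] <;> noncomm_ring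

/-- Elimination of an even generator `v`: if `K + F v` is minimally generated by `v` and the elements
`w` of `t`, then the iterated brackets `[…[[w, v], v]…, v]` generate the ideal `K` modulo its own
brackets. Their leading terms are the left independent elements `w vᵏ`. -/
theorem isTight_of_sup_span_of_even (hV : V.IsConnected) (hKh : V.tensorLie.IsHomogeneous K)
    (hKε : K ≤ augIdeal F E) (hn : Even n) (hv : v ∈ V.tensorLie.part n) (hvε : v ∈ augIdeal F E)
    (hvK : ∀ x ∈ K, V.tensorLie.br x v ∈ K) (hn0 : 0 < n) {t : Set (TensorAlgebra F E)}
    (hth : ∀ x ∈ t, ∃ m, x ∈ V.tensorLie.part m)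
    (hKt : K ≤ V.tensorLie.derived (K ⊔ Submodule.span F {v}) ⊔ Submodule.span F t)
    (hli : LinearIndependent (TensorAlgebra F E) fun o : Option t => o.elim v (↑)) :
    V.IsTight K := by
  set R := V.tensorLie.br.flip v with hR
  have hRbr : ∀ x, R x = V.tensorLie.br x v := fun x => LinearMap.flip_apply _ _ _
  have hRv : ∀ x, R x = x * v - v * x := tensorLie_br_apply_of_even hn hv
  let y : ℕ × t → TensorAlgebra F E := fun p => p.2 * v ^ p.1
  let z : ℕ × t → TensorAlgebra F E := fun p => (R ^ p.1) p.2
  have hRz : ∀ k i, R (z (k, i)) = z (k + 1, i) := fun k i => by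
    simp only [z, pow_succ', Module.End.mul_apply]
  set U := (Submodule.span (TensorAlgebra F E) (Set.range y)).restrictScalars F with hU
  have hUmul : ∀ (a : TensorAlgebra F E), ∀ b ∈ U, a * b ∈ U := fun a b hb =>
    Submodule.smul_mem (Submodule.span (TensorAlgebra F E) (Set.range y)) a hb
  have hUv : ∀ u ∈ U, u * v ∈ U := by
    intro u hu
    refine Submodule.span_induction (p := fun u _ => u * v ∈ U) ?_ (by simp) ?_ ?_ hu
    · rintro _ ⟨⟨k, i⟩, rfl⟩
      have : y (k, i) * v = y (k + 1, i) := by simp [y, pow_succ, mul_assoc]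
      rw [this]
      exact Submodule.subset_span ⟨_, rfl⟩
    · intro a b _ _ ha hb
      rw [add_mul]
      exact add_mem ha hb
    · intro a b _ hb
      rw [smul_eq_mul, mul_assoc]
      exact hUmul _ _ hb
  have hzy : ∀ k i, z (k, i) - y (k, i) ∈ augIdeal F E * U := by
    intro k i
    induction k with
    | zero => simp [z, y]
    | succ k ih =>
      have hzU : z (k, i) ∈ U := by
        have h1 : z (k, i) - y (k, i) ∈ U :=
          Submodule.mul_le.2 (fun a _ b hb => hUmul a b hb) ih
        have h2 : y (k, i) ∈ U := Submodule.subset_span ⟨_, rfl⟩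
        simpa using add_mem h1 h2
      have h1 : z (k + 1, i) - y (k + 1, i) = (z (k, i) - y (k, i)) * v - v * z (k, i) := by
        rw [← hRz, hRv]
        simp only [y, pow_succ]
        noncomm_ring
      rw [h1]
      refine sub_mem ?_ (Submodule.mul_mem_mul hvε hzU)
      refine Submodule.mul_induction_on ih ?_ fun a b ha hb => by
        rw [add_mul]
        exact add_mem ha hb
      intro a ha b hb
      rw [mul_assoc]
      exact Submodule.mul_mem_mul ha (hUv b hb)
  have hzh : ∀ k i, ∃ m, z (k, i) ∈ V.tensorLie.part m := by
    intro k i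
    induction k with
    | zero => exact hth i i.2
    | succ k ih =>
      obtain ⟨m, hm⟩ := ih
      exact ⟨m + n, by rw [← hRz, hRbr]; exact V.tensorLie.br_mem hm hv⟩
  refine isTight_of_linearIndependent hV hKh hKε hli.mul_pow (z := z) (fun p => hzh p.1 p.2)
    (fun p => hzy p.1 p.2) ?_
  set T := V.tensorLie.derived K ⊔ Submodule.span F (Set.range z) with hT
  have hRT : T ≤ T.comap R := by
    refine sup_le (fun x hx => ?_) (Submodule.span_le.2 ?_)
    · exact Submodule.mem_sup_left (GrLie.br_br_mem_derived hKh hv hvK hx)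
    · rintro _ ⟨⟨k, i⟩, rfl⟩
      exact Submodule.mem_sup_right (Submodule.subset_span ⟨(k + 1, i), (hRz k i).symm⟩)
  have hpos : ∀ n ≤ 0, K ⊓ V.tensorLie.part n = ⊥ := fun n hn =>
    eq_bot_iff.2 ((inf_le_inf_right _ hKε).trans (tensorPart_inf_augIdeal hV hn).le)
  let s : Set (TensorAlgebra F E) := {x | x ∈ V.tensorLie.homogeneousBrackets K ∨
    (∃ m, ∃ a ∈ K, a ∈ V.tensorLie.part m ∧ x = R a) ∨ x ∈ t}
  refine hKh.le_of_generators (s := s) hpos ?_ ?_ ?_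
  · rintro x (hx | ⟨m, a, -, ham, rfl⟩ | hx)
    · exact GrLie.homogeneousBrackets_homogeneous hx
    · exact ⟨m + n, by rw [hRbr]; exact V.tensorLie.br_mem ham hv⟩
    · exact hth x hx
  · refine (hKt.trans (sup_le_sup_right (GrLie.derived_sup_span_le hKh hv) _)).trans ?_
    refine sup_le (sup_le (sup_le ?_ ?_) ?_) (Submodule.span_mono fun x hx => Or.inr (Or.inr hx))
    · rw [GrLie.derived_eq_span hKh]
      exact Submodule.span_mono fun x hx => Or.inl hx
    · rw [Submodule.map_le_iff_le_comap]
      exact hKh.le_of_forall fun m a ha ham =>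
        Submodule.subset_span (Or.inr (Or.inl ⟨m, a, ha, ham, rfl⟩))
    · have h1 : V.tensorLie.br v v = 0 := by rw [tensorLie_br_apply_of_even hn hv, sub_self]
      rw [h1]
      simp
  · rintro m hm x (⟨i, j, a, ha, hai, b, hb, hbj, rfl⟩ | ⟨i, a, ha, hai, rfl⟩ | hx) hxm
    · exact Submodule.mem_sup_left (GrLie.br_mem_derived ha hb)
    · by_cases h0 : R a = 0
      · rw [h0]
        exact zero_mem _
      · have h1 : i + n = m :=
          GrSpace.eq_of_mem_part (V := V.tensorLie.toGrSpace) h0 (by rw [hRbr]; exact V.tensorLie.br_mem hai hv) hxm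
        exact hRT (hm i (by omega) ⟨ha, hai⟩)
    · exact Submodule.mem_sup_right (Submodule.subset_span ⟨(0, ⟨x, hx⟩), by simp [z]⟩)

/-- Elimination of an odd generator `v`: if `K + F v` is minimally generated by `v` and the elements
`w` of `t`, then `w`, `[w, v]` and `v² = [v, v] / 2` generate the ideal `K` modulo its own brackets.
Their leading terms are the left independent elements `w`, `w v` and `v v`. -/
theorem isTight_of_sup_span_of_odd (hV : V.IsConnected) (h2 : (2 : F) ≠ 0)
    (hKh : V.tensorLie.IsHomogeneous K)
    (hKε : K ≤ augIdeal F E) (hn : Odd n) (hv : v ∈ V.tensorLie.part n) (hvε : v ∈ augIdeal F E)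
    (hvK : ∀ x ∈ K, V.tensorLie.br x v ∈ K) (hvv : V.tensorLie.br v v ∈ K)
    {t : Set (TensorAlgebra F E)}
    (hth : ∀ x ∈ t, ∃ m, x ∈ V.tensorLie.part m)
    (hKt : K ≤ V.tensorLie.derived (K ⊔ Submodule.span F {v}) ⊔ Submodule.span F t)
    (hli : LinearIndependent (TensorAlgebra F E) fun o : Option t => o.elim v (↑)) :
    V.IsTight K := by
  set R := V.tensorLie.br.flip v with hR
  have hRbr : ∀ x, R x = V.tensorLie.br x v := fun x => LinearMap.flip_apply _ _ _
  have hsq : v * v ∈ K := by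
    rw [tensorLie_br_self_of_odd hn hv] at hvv
    exact (Submodule.smul_mem_iff _ h2).1 hvv
  have hsqn : v * v ∈ V.tensorLie.part (n + n) := mul_mem_tensorLie_part hv hv
  let x : Option t → TensorAlgebra F E := fun o => o.elim v (↑)
  let y : t ⊕ Option t → TensorAlgebra F E := Sum.elim (↑) fun o => x o * v
  let z : t ⊕ Option t → TensorAlgebra F E :=
    Sum.elim (↑) fun o => o.elim (v * v) fun i => R i
  have hy : LinearIndependent (TensorAlgebra F E) y := hli.sum_elim_mul hli
  refine isTight_of_linearIndependent hV hKh hKε hy (z := z) ?_ ?_ ?_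
  · rintro (i | _ | i)
    · exact hth i i.2
    · exact ⟨n + n, hsqn⟩
    · obtain ⟨m, hm⟩ := hth i i.2
      refine ⟨m + n, ?_⟩
      change R i ∈ _
      rw [hRbr]
      exact V.tensorLie.br_mem hm hv
  · rintro (i | _ | i)
    · simp [y, z]
    · simp [y, z, x]
    · obtain ⟨m, hm⟩ := hth i i.2
      have h1 : z (Sum.inr (some i)) - y (Sum.inr (some i)) =
          -((m * n).negOnePow • (v * (i : TensorAlgebra F E))) := by
        simp [y, z, x, hR, V.tensorLie_br_apply hm hv]
      rw [h1]
      refine neg_mem ((GrLie.units_smul_mem_iff _).2 (Submodule.mul_mem_mul hvε ?_))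
      exact Submodule.subset_span ⟨Sum.inl i, rfl⟩
  set T := V.tensorLie.derived K ⊔ Submodule.span F (Set.range z) with hT
  have hzT : ∀ p, z p ∈ T := fun p => Submodule.mem_sup_right (Submodule.subset_span ⟨p, rfl⟩)
  have hKt' := hKt.trans (sup_le_sup_right (GrLie.derived_sup_span_le hKh hv) _)
  have htT : Submodule.span F t ≤ T := Submodule.span_le.2 fun i hi => hzT (Sum.inl ⟨i, hi⟩)
  have hvvT : Submodule.span F {V.tensorLie.br v v} ≤ T := by
    rw [Submodule.span_singleton_le_iff_mem, tensorLie_br_self_of_odd hn hv]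
    exact Submodule.smul_mem _ _ (hzT (Sum.inr none))
  refine hKt'.trans (sup_le (sup_le (sup_le le_sup_left ?_) hvvT) htT)
  rw [Submodule.map_le_iff_le_comap]
  refine hKt'.trans (sup_le (sup_le (sup_le ?_ ?_) ?_) ?_)
  · exact fun x hx => Submodule.mem_sup_left (GrLie.br_br_mem_derived hKh hv hvK hx)
  · rw [Submodule.map_le_iff_le_comap]
    refine hKh.le_of_forall fun m a ha ham => ?_
    refine Submodule.mem_sup_left ?_
    have h1 : R (R a) = V.tensorLie.br a (v * v) := by
      rw [hRbr, hRbr, tensorLie_br_br_of_odd hn hv ham]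
    rw [h1]
    exact GrLie.br_mem_derived ha hsq
  · rw [Submodule.span_singleton_le_iff_mem, tensorLie_br_self_of_odd hn hv]
    refine Submodule.smul_mem _ _ ?_
    have h1 : R (v * v) = 0 := by
      rw [hR, LinearMap.flip_apply, V.tensorLie_br_apply hsqn hv,
        Int.negOnePow_even _ ((Even.add_self n).mul_right n), one_smul, mul_assoc, sub_self]
    rw [Submodule.mem_comap, h1]
    exact zero_mem _
  · exact Submodule.span_le.2 fun i hi => hzT (Sum.inr (some ⟨i, hi⟩))

/-- Tightness passes to an ideal of codimension one. -/
theorem isTight_of_sup_span (hV : V.IsConnected) (h2 : (2 : F) ≠ 0)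
    (hKh : V.tensorLie.IsHomogeneous K)
    (hKs : V.tensorLie.IsSubalgebra K)
    (hKε : K ≤ augIdeal F E) (hv : v ∈ V.tensorLie.part n) (hvε : v ∈ augIdeal F E)
    (hvK : ∀ x ∈ K, V.tensorLie.br x v ∈ K) (hvv : V.tensorLie.br v v ∈ K)
    (ht : V.IsTight (K ⊔ Submodule.span F {v})) : V.IsTight K := by
  by_cases hvmem : v ∈ K
  · rwa [sup_eq_left.2 ((Submodule.span_singleton_le_iff_mem _ _).2 hvmem)] at ht
  have hDK : V.tensorLie.derived (K ⊔ Submodule.span F {v}) ≤ K := by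
    refine (GrLie.derived_sup_span_le hKh hv).trans (sup_le (sup_le hKs.derived_le ?_) ?_)
    · rintro _ ⟨x, hx, rfl⟩
      exact hvK x hx
    · exact (Submodule.span_singleton_le_iff_mem _ _).2 hvv
  obtain ⟨t, htK, hth, hKt, hind⟩ :=
    hKh.exists_family (V.tensorLie.derived (K ⊔ Submodule.span F {v}))
  have hli : LinearIndependent (TensorAlgebra F E) fun o : Option t => o.elim v (↑) := by
    refine ht.linearIndependent ?_ fun c hc => ?_
    · rintro (_ | i)
      · exact Submodule.mem_sup_right (Submodule.mem_span_singleton_self v)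
      · exact Submodule.mem_sup_left (htK i i.2)
    · have hsum : Finsupp.linearCombination F (fun o : Option t => o.elim v (↑)) c =
          c none • v + Finsupp.linearCombination F ((↑) : t → TensorAlgebra F E) c.some := by
        rw [Finsupp.linearCombination_apply, Finsupp.sum_option_index_smul]
        rfl
      have hsK : Finsupp.linearCombination F ((↑) : t → TensorAlgebra F E) c.some ∈ K :=
        Submodule.sum_mem _ fun i _ => Submodule.smul_mem _ _ (htK i i.2)
      have hnone : c none = 0 := by
        by_contra h0
        have h1 := sub_mem (hDK hc) hsK
        rw [hsum, add_sub_cancel_right] at h1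
        exact hvmem ((Submodule.smul_mem_iff _ h0).1 h1)
      rw [hsum, hnone, zero_smul, zero_add] at hc
      have hsome := hind _ hc
      ext (_ | i)
      · exact hnone
      · exact DFunLike.congr_fun hsome i
  rcases Int.even_or_odd n with hn | hn
  · have hn0 : 0 < n := by
      by_contra h0
      have h1 : v ∈ augIdeal F E ⊓ V.tensorLie.part n := ⟨hvε, hv⟩
      rw [tensorPart_inf_augIdeal hV (not_lt.1 h0), Submodule.mem_bot] at h1
      exact hvmem (h1 ▸ zero_mem K)
    exact isTight_of_sup_span_of_even hV hKh hKε hn hv hvε hvK hn0 hth hKt hli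
  · exact isTight_of_sup_span_of_odd hV h2 hKh hKε hn hv hvε hvK hvv hth hKt hli

end GrSpace

/-! ### Graded subalgebras of a free Lie algebra are tight -/

namespace GrSpace

open TensorAlgebra

variable {F : Type*} {E : Type*} [Field F] [AddCommGroup E] [Module F E] {V : GrSpace F E}

theorem algebraMapInv_eq_zero_of_mem_part {n : ℤ} (hn : n ≠ 0) {x : TensorAlgebra F E}
    (hx : x ∈ V.tensorLie.part n) : algebraMapInv x = (0 : F) := by
  rw [tensorLie_part] at hx
  have h : V.tensorPart n ≤ augIdeal F E := by
    refine Submodule.span_le.2 ?_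
    rintro _ ⟨l, hl, rfl⟩
    rcases l with _ | ⟨p, l⟩
    · exact absurd (by simpa using hl) hn.symm
    · simp [mem_augIdeal, algebraMapInv]
  exact h hx

theorem tensorLie_br_mem_augIdeal (x y : TensorAlgebra F E) :
    V.tensorLie.br x y ∈ augIdeal F E := by
  refine V.tensorLie.homogeneous_induction (p := fun x => V.tensorLie.br x y ∈ augIdeal F E) x
    (fun i x hx => ?_) fun a b ha hb => by simpa using add_mem ha hb
  refine V.tensorLie.homogeneous_induction (p := fun y => V.tensorLie.br x y ∈ augIdeal F E) y
    (fun j y hy => ?_) fun a b ha hb => by simpa using add_mem ha hb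
  rw [V.tensorLie_br_apply hx hy]
  by_cases hi : i = 0
  · simp [mem_augIdeal, hi, mul_comm]
  · have hx' : x ∈ augIdeal F E := algebraMapInv_eq_zero_of_mem_part hi hx
    exact sub_mem (mul_mem_augIdeal_left hx' y)
      ((GrLie.units_smul_mem_iff _).2 (mul_mem_augIdeal_right hx' y))

variable (V) in
theorem freeLieSpace_le_augIdeal : V.freeLieSpace ≤ augIdeal F E := by
  refine sInf_le ⟨?_, fun x _ y _ => tensorLie_br_mem_augIdeal x y⟩
  rintro _ ⟨v, rfl⟩
  simp [mem_augIdeal, algebraMapInv]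

variable (V) in
theorem isSubalgebra_freeLieSpace : V.tensorLie.IsSubalgebra V.freeLieSpace :=
  V.tensorLie.isSubalgebra_closure _

variable (V) in
theorem isHomogeneous_freeLieSpace : V.tensorLie.IsHomogeneous V.freeLieSpace :=
  V.tensorLie.isHomogeneous_closure _ V.isHomogeneous_range_ι

variable (V) in
theorem freeLieSpace_le_derived_sup :
    V.freeLieSpace ≤ V.tensorLie.derived V.freeLieSpace ⊔ LinearMap.range (ι F) := by
  have hle : V.tensorLie.derived V.freeLieSpace ⊔ LinearMap.range (ι F) ≤ V.freeLieSpace :=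
    sup_le V.isSubalgebra_freeLieSpace.derived_le (V.tensorLie.le_closure _)
  exact sInf_le ⟨le_sup_right, fun x hx y hy =>
    Submodule.mem_sup_left (GrLie.br_mem_derived (hle hx) (hle hy))⟩

variable (V) in
/-- The free Lie algebra is tight: products of two elements of the augmentation ideal have no
component of word length one. -/
theorem isTight_freeLieSpace : V.IsTight V.freeLieSpace := by
  rintro u ⟨huL, hu⟩
  obtain ⟨d, hd, _, ⟨v, rfl⟩, rfl⟩ := Submodule.mem_sup.1 (V.freeLieSpace_le_derived_sup huL)
  have h1 : ι F v ∈ augIdeal F E * augIdeal F E := by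
    have h2 := sub_mem hu
      (derived_le_augIdeal_mul V.isHomogeneous_freeLieSpace V.freeLieSpace_le_augIdeal hd)
    rw [add_sub_cancel_left] at h2
    exact mul_le_mul' le_rfl V.freeLieSpace_le_augIdeal h2
  -- generators are not decomposable: detect `v` by the derivations of the tensor algebra
  have hv : v = 0 := by
    refine (Module.forall_dual_apply_eq_zero_iff F v).1 fun φ => ?_
    have h2 : augIdeal F E * augIdeal F E ≤ (augIdeal F E).comap (letterDeriv φ) := by
      refine Submodule.mul_le.2 fun a ha b hb => ?_
      rw [Submodule.mem_comap, letterDeriv_mul_apply, mem_augIdeal.1 ha, zero_smul, add_zero]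
      exact mul_mem_augIdeal_right hb _
    have h3 := h2 h1
    rw [Submodule.mem_comap, letterDeriv_ι, mem_augIdeal] at h3
    simpa using h3
  rw [hv, map_zero, add_zero]
  exact hd

theorem freeLieSpace_inf_part (hV : V.IsConnected) (n : ℤ) (hn : n ≤ 0) :
    V.freeLieSpace ⊓ V.tensorLie.part n = ⊥ :=
  eq_bot_iff.2 ((inf_le_inf_right _ V.freeLieSpace_le_augIdeal).trans
    (tensorPart_inf_augIdeal hV hn).le)

variable {K : Submodule F (TensorAlgebra F E)}

/-- In a connected free Lie algebra, brackets with elements of dimension at least `n` have dimension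
greater than `n`; they lie in any `T` that contains everything in these dimensions. -/
theorem br_mem_of_freeLieSpace (hV : V.IsConnected) (hKh : V.tensorLie.IsHomogeneous K)
    (hKL : K ≤ V.freeLieSpace) {S : Submodule F (TensorAlgebra F E)} {n : ℤ}
    (hSh : V.tensorLie.IsHomogeneous S) (hSL : S ≤ V.freeLieSpace)
    (hS : ∀ m < n, S ⊓ V.tensorLie.part m = ⊥) {T : Submodule F (TensorAlgebra F E)}
    (hT : ∀ m, n < m → V.freeLieSpace ⊓ V.tensorLie.part m ≤ T) :
    (∀ a ∈ K, ∀ b ∈ S, V.tensorLie.br a b ∈ T) ∧ ∀ a ∈ S, ∀ b ∈ K, V.tensorLie.br a b ∈ T := by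
  have H : ∀ i j, ∀ a ∈ K, a ∈ V.tensorLie.part i → ∀ b ∈ S, b ∈ V.tensorLie.part j →
      V.tensorLie.br a b ∈ T := by
    intro i j a ha hai b hb hbj
    by_cases hj : j < n
    · have h0 : b ∈ S ⊓ V.tensorLie.part j := ⟨hb, hbj⟩
      rw [hS j hj, Submodule.mem_bot] at h0
      simp [h0]
    · by_cases hi : i ≤ 0
      · have h0 : a ∈ V.freeLieSpace ⊓ V.tensorLie.part i := ⟨hKL ha, hai⟩
        rw [freeLieSpace_inf_part hV i hi, Submodule.mem_bot] at h0
        simp [h0]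
      · exact hT (i + j) (by omega) ⟨V.isSubalgebra_freeLieSpace a (hKL ha) b (hSL hb),
          V.tensorLie.br_mem hai hbj⟩
  exact ⟨GrLie.br_mem_of_homogeneous hKh hSh H, GrLie.br_mem_of_homogeneous hSh hKh
    fun j i b hb hbj a ha hai => GrLie.br_swap_mem hai hbj (H i j a ha hai b hb hbj)⟩

/-- Enlarging a subspace `K` by elements of dimension at least `n` only adds brackets in dimensions
greater than `n`. -/
theorem br_sup_mem (hV : V.IsConnected) (hKh : V.tensorLie.IsHomogeneous K)
    (hKL : K ≤ V.freeLieSpace)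
    {S : Submodule F (TensorAlgebra F E)} {n : ℤ}
    (hSh : V.tensorLie.IsHomogeneous S) (hSL : S ≤ V.freeLieSpace)
    (hS : ∀ m < n, S ⊓ V.tensorLie.part m = ⊥) {T : Submodule F (TensorAlgebra F E)}
    (hT : ∀ m, n < m → V.freeLieSpace ⊓ V.tensorLie.part m ≤ T) :
    ∀ x ∈ K ⊔ S, ∀ y ∈ K ⊔ S, V.tensorLie.br x y ∈ V.tensorLie.derived K ⊔ T := by
  have H1 := br_mem_of_freeLieSpace hV hKh hKL hSh hSL hS hT
  have H2 := br_mem_of_freeLieSpace hV hSh hSL hSh hSL hS hT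
  intro x hx y hy
  obtain ⟨a, ha, s, hs, rfl⟩ := Submodule.mem_sup.1 hx
  obtain ⟨b, hb, t, ht, rfl⟩ := Submodule.mem_sup.1 hy
  simp only [map_add, LinearMap.add_apply]
  exact add_mem
    (add_mem (Submodule.mem_sup_left (GrLie.br_mem_derived ha hb))
      (Submodule.mem_sup_right (H1.2 s hs b hb)))
    (add_mem (Submodule.mem_sup_right (H1.1 a ha t ht))
      (Submodule.mem_sup_right (H2.1 s hs t ht)))

theorem inf_part_eq_bot_of_le_part {S : Submodule F (TensorAlgebra F E)} {n m : ℤ}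
    (hS : S ≤ V.tensorLie.part n) (h : m ≠ n) : S ⊓ V.tensorLie.part m = ⊥ := by
  rw [eq_bot_iff]
  rintro x ⟨hxS, hxm⟩
  by_contra hx
  exact h (eq_of_mem_part hx hxm (hS hxS))

/-- Tightness descends along the removal of finitely many elements of dimension `n`, as long as
everything in dimensions greater than `n` is kept. One element at a time, each step passes to an
ideal of codimension one. -/
theorem isTight_of_sup_finset (hV : V.IsConnected) (h2 : (2 : F) ≠ 0)
    (hKh : V.tensorLie.IsHomogeneous K)
    (hKs : V.tensorLie.IsSubalgebra K) (hKL : K ≤ V.freeLieSpace) {n : ℤ}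
    (hK : ∀ m, n < m → V.freeLieSpace ⊓ V.tensorLie.part m ≤ K)
    (s : Finset (TensorAlgebra F E))
    (hs : ∀ x ∈ s, x ∈ V.freeLieSpace ⊓ V.tensorLie.part n)
    (ht : V.IsTight (K ⊔ Submodule.span F s)) : V.IsTight K := by
  classical
  induction s using Finset.induction_on with
  | empty => simpa using ht
  | insert v s hv ih =>
    have hle : ∀ t : Finset (TensorAlgebra F E),
        (∀ x ∈ t, x ∈ V.freeLieSpace ⊓ V.tensorLie.part n) →
        Submodule.span F t ≤ V.freeLieSpace ⊓ V.tensorLie.part n := fun t ht =>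
      Submodule.span_le.2 ht
    have hbr : ∀ t : Finset (TensorAlgebra F E),
        (∀ x ∈ t, x ∈ V.freeLieSpace ⊓ V.tensorLie.part n) →
        ∀ x ∈ K ⊔ Submodule.span F t, ∀ y ∈ K ⊔ Submodule.span F t, V.tensorLie.br x y ∈ K := by
      intro t ht x hx y hy
      have h1 := br_sup_mem hV hKh hKL
        (isHomogeneous_of_le_part ((hle t ht).trans inf_le_right)) ((hle t ht).trans inf_le_left)
        (fun m hm => inf_part_eq_bot_of_le_part ((hle t ht).trans inf_le_right) hm.ne) hK x hx y hy
      rwa [sup_eq_right.2 hKs.derived_le] at h1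
    have hs' : ∀ x ∈ s, x ∈ V.freeLieSpace ⊓ V.tensorLie.part n := fun x hx =>
      hs x (Finset.mem_insert_of_mem hx)
    have hvL := hs v (Finset.mem_insert_self v s)
    refine ih hs' ?_
    have hmono : K ⊔ Submodule.span F s ≤ K ⊔ Submodule.span F (insert v s : Finset _) :=
      sup_le_sup_left (Submodule.span_mono (by simp)) K
    have hvmem : v ∈ K ⊔ Submodule.span F (insert v s : Finset _) :=
      Submodule.mem_sup_right (Submodule.subset_span (by simp))
    have hK1 : K ⊔ Submodule.span F s ≤ V.freeLieSpace :=
      sup_le hKL ((hle s hs').trans inf_le_left)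
    refine isTight_of_sup_span hV h2
      (hKh.sup (isHomogeneous_of_le_part ((hle s hs').trans inf_le_right)))
      (fun x hx y hy => Submodule.mem_sup_left (hbr s hs' x hx y hy))
      (hK1.trans V.freeLieSpace_le_augIdeal) hvL.2 (V.freeLieSpace_le_augIdeal hvL.1)
      (fun x hx => Submodule.mem_sup_left (hbr _ hs x (hmono hx) v hvmem))
      (Submodule.mem_sup_left (hbr _ hs v hvmem v hvmem)) ?_
    rw [Finset.coe_insert, Submodule.span_insert] at ht
    rwa [sup_assoc, sup_comm (Submodule.span F _) (Submodule.span F {v})]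

/-- Graded subalgebras that contain everything in dimensions at least `N` are tight. -/
theorem isTight_of_le_of_dimension (hV : V.IsConnected) (h2 : (2 : F) ≠ 0)
    (hfin : ∀ n, FiniteDimensional F (V.freeLieSpace ⊓ V.tensorLie.part n : Submodule F _))
    (N : ℕ) : ∀ K : Submodule F (TensorAlgebra F E), V.tensorLie.IsHomogeneous K →
      V.tensorLie.IsSubalgebra K → K ≤ V.freeLieSpace →
      (∀ m : ℤ, N ≤ m → V.freeLieSpace ⊓ V.tensorLie.part m ≤ K) → V.IsTight K := by
  induction N with
  | zero =>
    intro K _ _ hKL hK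
    have h : K = V.freeLieSpace := by
      refine le_antisymm hKL (V.isHomogeneous_freeLieSpace.le_of_forall fun n x hx hn => ?_)
      by_cases h0 : 0 ≤ n
      · exact hK n (by simpa using h0) ⟨hx, hn⟩
      · have h1 : x ∈ V.freeLieSpace ⊓ V.tensorLie.part n := ⟨hx, hn⟩
        rw [freeLieSpace_inf_part hV n (by omega), Submodule.mem_bot] at h1
        rw [h1]
        exact zero_mem _
    rw [h]
    exact V.isTight_freeLieSpace
  | succ N ih =>
    intro K hKh hKs hKL hK
    obtain ⟨s, hs⟩ := (Submodule.fg_iff_finiteDimensional _).2 (hfin N)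
    have hK' : ∀ m : ℤ, N < m → V.freeLieSpace ⊓ V.tensorLie.part m ≤ K := fun m hm =>
      hK m (by push_cast; omega)
    refine isTight_of_sup_finset hV h2 hKh hKs hKL hK' s
      (fun x hx => hs ▸ Submodule.subset_span hx) ?_
    have hSp : Submodule.span F (s : Set _) ≤ V.tensorLie.part N := hs.le.trans inf_le_right
    have hSL : Submodule.span F (s : Set _) ≤ V.freeLieSpace := hs.le.trans inf_le_left
    refine ih _ (hKh.sup (isHomogeneous_of_le_part hSp)) (fun x hx y hy => ?_)
      (sup_le hKL hSL) fun m hm => ?_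
    · have h1 := br_sup_mem hV hKh hKL (isHomogeneous_of_le_part hSp) hSL
        (fun m hm => inf_part_eq_bot_of_le_part hSp hm.ne) hK' x hx y hy
      rw [sup_eq_right.2 hKs.derived_le] at h1
      exact Submodule.mem_sup_left h1
    · rcases hm.eq_or_lt with rfl | hm
      · rw [hs]
        exact le_sup_right
      · exact (hK' m hm).trans le_sup_left

/-- Every graded subalgebra of a connected free Lie algebra of finite type is tight. -/
theorem isTight_of_le_freeLieSpace (hV : V.IsConnected) (h2 : (2 : F) ≠ 0)
    (hfin : ∀ n, FiniteDimensional F (V.freeLieSpace ⊓ V.tensorLie.part n : Submodule F _))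
    (hKh : V.tensorLie.IsHomogeneous K) (hKs : V.tensorLie.IsSubalgebra K)
    (hKL : K ≤ V.freeLieSpace) : V.IsTight K := by
  rintro y ⟨hyK, hy⟩
  refine mem_of_proj_mem (V := V.tensorLie.toGrSpace) fun n => ?_
  -- in dimension `n`, replace `K` by its sum with all of the free Lie algebra in dimensions above
  let S : Submodule F (TensorAlgebra F E) :=
    ⨆ m : Set.Ici (n.toNat + 1), V.freeLieSpace ⊓ V.tensorLie.part (m : ℕ)
  have hSh : V.tensorLie.IsHomogeneous S :=
    isHomogeneous_iSup fun m => isHomogeneous_of_le_part inf_le_right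
  have hSL : S ≤ V.freeLieSpace := iSup_le fun m => inf_le_left
  have hproj : ∀ m : ℤ, m < n.toNat + 1 → ∀ x ∈ S, V.tensorLie.proj m x = 0 := by
    intro m hm x hx
    have : S ≤ LinearMap.ker (V.tensorLie.proj m) := iSup_le fun k x hx =>
      proj_of_mem_ne (by have := k.2; simp only [Set.mem_Ici] at this; omega) hx.2
    exact this hx
  have hS : ∀ m : ℤ, m < n.toNat + 1 → S ⊓ V.tensorLie.part m = ⊥ := by
    intro m hm
    rw [eq_bot_iff]
    rintro x ⟨hxS, hxm⟩
    rw [Submodule.mem_bot, ← proj_of_mem hxm, hproj m hm x hxS]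
  have hT : ∀ m : ℤ, (n.toNat : ℤ) + 1 ≤ m → V.freeLieSpace ⊓ V.tensorLie.part m ≤ S := by
    intro m hm
    obtain ⟨k, rfl⟩ := Int.eq_ofNat_of_zero_le (show 0 ≤ m by omega)
    exact le_iSup (fun m : Set.Ici (n.toNat + 1) => V.freeLieSpace ⊓ V.tensorLie.part (m : ℕ))
      ⟨k, by simp only [Set.mem_Ici]; omega⟩
  have hbr := br_sup_mem hV hKh hKL hSh hSL hS fun m hm => hT m hm.le
  have ht : V.IsTight (K ⊔ S) := by
    refine isTight_of_le_of_dimension hV h2 hfin (n.toNat + 1) _ (hKh.sup hSh)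
      (fun x hx y hy => ?_) (sup_le hKL hSL) fun m hm => ?_
    · exact sup_le_sup_right hKs.derived_le S (hbr x hx y hy)
    · exact (hT m (by push_cast at hm; exact hm)).trans le_sup_right
  have hle : augIdeal F E * K ≤ augIdeal F E * (K ⊔ S) := mul_le_mul' le_rfl le_sup_left
  have h1 := ht ⟨Submodule.mem_sup_left hyK, hle hy⟩
  obtain ⟨d, hd, s, hs, rfl⟩ := Submodule.mem_sup.1 (Submodule.map₂_le.2 hbr h1)
  rw [map_add, hproj n (by omega) s hs, add_zero]
  exact (GrLie.isHomogeneous_derived hKh).proj_mem hd n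

end GrSpace

/-! ### The representation induced from the complement of a free ideal -/

namespace GrSpace

variable {F : Type*} {M : Type*} [Field F] [AddCommGroup M] [Module F M] (V : GrSpace F M)

theorem coe_freeLie_br (a b : V.freeLieSpace) :
    (V.freeLie.br a b : TensorAlgebra F M) = V.tensorLie.br a b := rfl

theorem coe_freeLieι (v : M) : (V.freeLieι v : TensorAlgebra F M) = TensorAlgebra.ι F v := rfl

theorem freeLieι_mem_part {n : ℤ} {v : M} (hv : v ∈ V.part n) :
    V.freeLieι v ∈ V.freeLie.part n := V.ι_mem_tensorPart hv

/-- A subspace of the tensor algebra that contains `1` and is stable under left multiplication by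
homogeneous generators is everything. -/
theorem mem_of_ι_mul_mem {S : Submodule F (TensorAlgebra F M)} (h1 : 1 ∈ S)
    (h : ∀ n, ∀ v ∈ V.part n, ∀ a ∈ S, TensorAlgebra.ι F v * a ∈ S) (a : TensorAlgebra F M) :
    a ∈ S := by
  refine V.tensorLie.homogeneous_induction (p := fun a => a ∈ S) a (fun n x hx => ?_)
    fun x y hx hy => add_mem hx hy
  refine Submodule.span_le.2 ?_ hx
  rintro _ ⟨l, -, rfl⟩
  induction l with
  | nil => simpa using h1
  | cons p l ih =>
    rw [List.map_cons, List.prod_cons]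
    exact h p.1 _ p.2.2 _ ih

end GrSpace

namespace GrLie

open GrSpace

/-- An injective homomorphism reflects dimensions. -/
theorem Hom.injective_mem_part {F E E' : Type*} [Field F] [AddCommGroup E] [Module F E]
    [AddCommGroup E'] [Module F E'] {L : GrLie F E} {L' : GrLie F E'} (f : Hom L L')
    (hf : Function.Injective f.toLinearMap) {x : E} {n : ℤ} (hx : f.toLinearMap x ∈ L'.part n) :
    x ∈ L.part n := by
  have h : L'.proj n ∘ₗ f.toLinearMap = f.toLinearMap ∘ₗ L.proj n := by
    refine L.linearMap_ext fun m y hy => ?_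
    by_cases hmn : m = n
    · subst hmn
      simp [proj_of_mem hy, proj_of_mem (f.map_part m y hy)]
    · simp [proj_of_mem_ne hmn hy, proj_of_mem_ne hmn (f.map_part m y hy)]
  have h1 : f.toLinearMap x = f.toLinearMap (L.proj n x) := by
    rw [← LinearMap.comp_apply, ← h, LinearMap.comp_apply, proj_of_mem hx]
  rw [hf h1]
  exact proj_mem n x

variable {F E M : Type*} [Field F] [AddCommGroup E] [Module F E] [AddCommGroup M] [Module F M]

/-- A decomposition of a graded Lie algebra as the semidirect product of a graded subalgebra and an
ideal that is isomorphic to the free Lie algebra on `V`. -/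
structure FreeSemidirect (L : GrLie F E) (V : GrSpace F M) where
  /-- The complementary subalgebra. -/
  base : Submodule F E
  isSubalgebra_base : L.IsSubalgebra base
  isHomogeneous_base : L.IsHomogeneous base
  /-- The embedding of the free Lie algebra. -/
  f : Hom V.freeLie L
  injective : Function.Injective f.toLinearMap
  isIdeal : L.IsIdeal (LinearMap.range f.toLinearMap)
  isCompl : IsCompl base (LinearMap.range f.toLinearMap)

/-- The operator `x ↦ (-1)^{m|x|} x`. -/
noncomputable def signOp (L : GrLie F E) (m : ℤ) : E →ₗ[F] E :=
  L.isInternal.glue fun i => (i * m).negOnePow • (L.part i).subtype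

theorem signOp_apply (L : GrLie F E) (m : ℤ) {i : ℤ} {x : E} (hx : x ∈ L.part i) :
    L.signOp m x = (i * m).negOnePow • x := by
  rw [signOp, L.isInternal.glue_apply _ hx]
  rfl

namespace FreeSemidirect

variable {L : GrLie F E} {V : GrSpace F M} (S : FreeSemidirect L V)

/-- The projection onto the free ideal, with values in the tensor algebra. -/
noncomputable def pr : E →ₗ[F] TensorAlgebra F M :=
  V.freeLieSpace.subtype ∘ₗ
    LinearMap.linearProjOfIsCompl S.base S.f.toLinearMap S.injective S.isCompl.symm

theorem pr_f (b : V.freeLieSpace) : S.pr (S.f.toLinearMap b) = b := by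
  simp [pr]

theorem pr_base {x : E} (hx : x ∈ S.base) : S.pr x = 0 := by
  simp [pr, LinearMap.linearProjOfIsCompl_apply_right' _ _ _ _ x hx]

theorem mem_base_of_pr_eq_zero {x : E} (hx : S.pr x = 0) : x ∈ S.base := by
  rw [← LinearMap.ker_linearProjOfIsCompl S.base S.f.toLinearMap S.injective S.isCompl.symm,
    LinearMap.mem_ker]
  exact Subtype.ext hx

/-- The operator `v · ψ` on linear maps `ψ : L → TV`, given by
`(v · ψ)(x) = (-1)^{|x||v|} v ψ(x) + ψ([x, v])`. -/
noncomputable def letterOp : M →ₗ[F] Module.End F (E →ₗ[F] TensorAlgebra F M) :=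
  V.isInternal.glue (M := Module.End F (E →ₗ[F] TensorAlgebra F M)) fun m => LinearMap.mk₂ F
    (fun (v : V.part m) (ψ : E →ₗ[F] TensorAlgebra F M) =>
      LinearMap.mulLeft F (TensorAlgebra.ι F (v : M)) ∘ₗ ψ ∘ₗ L.signOp m +
        ψ ∘ₗ L.br.flip (S.f.toLinearMap (V.freeLieι v)))
    (fun v w ψ => by ext x; simp [add_mul]; abel)
    (fun c v ψ => by ext x; simp)
    (fun v ψ φ => by ext x; simp [mul_add]; abel)
    (fun c v ψ => by ext x; simp)

theorem letterOp_apply {m i : ℤ} {v : M} (hv : v ∈ V.part m) {x : E} (hx : x ∈ L.part i)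
    (ψ : E →ₗ[F] TensorAlgebra F M) :
    S.letterOp v ψ x = (i * m).negOnePow • (TensorAlgebra.ι F v * ψ x) +
      ψ (L.br x (S.f.toLinearMap (V.freeLieι v))) := by
  rw [letterOp, V.isInternal.glue_apply _ hv]
  simp only [LinearMap.mk₂_apply, LinearMap.add_apply, LinearMap.comp_apply, L.signOp_apply m hx,
    LinearMap.flip_apply, LinearMap.mulLeft_apply]
  rcases Int.units_eq_one_or (i * m).negOnePow with h | h <;> simp [h]

/-- The action of `L` on the tensor algebra on `V`, viewed as the module induced from the trivial
module of the complement of the free ideal: it is determined by `x · 1 = pr x` and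
`x · (v a) = (-1)^{|x||v|} v (x · a) + [x, v] · a`. -/
noncomputable def rho : E →ₗ[F] Module.End F (TensorAlgebra F M) :=
  ((LinearMap.applyₗ S.pr) ∘ₗ (TensorAlgebra.lift F S.letterOp).toLinearMap).flip

theorem rho_one (x : E) : S.rho x 1 = S.pr x := by
  simp [rho]

theorem rho_ι_mul {m i : ℤ} {v : M} (hv : v ∈ V.part m) {x : E} (hx : x ∈ L.part i)
    (a : TensorAlgebra F M) :
    S.rho x (TensorAlgebra.ι F v * a) = (i * m).negOnePow • (TensorAlgebra.ι F v * S.rho x a) +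
      S.rho (L.br x (S.f.toLinearMap (V.freeLieι v))) a := by
  simp [rho, S.letterOp_apply hv hx]

theorem f_mem_part {n : ℤ} {b : V.freeLieSpace}
    (hb : (b : TensorAlgebra F M) ∈ V.tensorLie.part n) : S.f.toLinearMap b ∈ L.part n :=
  S.f.map_part n b hb

/-- The free ideal acts by left multiplication. -/
theorem rho_f (b : V.freeLieSpace) (a : TensorAlgebra F M) :
    S.rho (S.f.toLinearMap b) a = b * a := by
  let T : Submodule F (TensorAlgebra F M) :=
    { carrier := {a | ∀ b : V.freeLieSpace, S.rho (S.f.toLinearMap b) a = b * a}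
      add_mem' := fun {x y} hx hy b => by rw [map_add, hx b, hy b, mul_add]
      zero_mem' := fun b => by simp
      smul_mem' := fun c x hx b => by rw [map_smul, hx b, mul_smul_comm] }
  suffices h : a ∈ T from h b
  refine V.mem_of_ι_mul_mem (fun b => by rw [rho_one, pr_f, mul_one]) ?_ a
  intro m v hv a ha b
  have h : S.rho.flip (TensorAlgebra.ι F v * a) ∘ₗ S.f.toLinearMap =
      (LinearMap.mulRight F (TensorAlgebra.ι F v * a)) ∘ₗ V.freeLieSpace.subtype := by
    refine V.freeLie.linearMap_ext fun i b hb => ?_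
    have hb' : (b : TensorAlgebra F M) ∈ V.tensorLie.part i := hb
    have hv' : TensorAlgebra.ι F v ∈ V.tensorLie.part m := V.ι_mem_tensorPart hv
    simp only [LinearMap.comp_apply, LinearMap.flip_apply, Submodule.subtype_apply,
      LinearMap.mulRight_apply]
    rw [S.rho_ι_mul hv (S.f_mem_part hb'), ← S.f.map_br, ha, ha, coe_freeLie_br, coe_freeLieι,
      V.tensorLie_br_apply hb' hv']
    rcases Int.units_eq_one_or (i * m).negOnePow with h | h <;>
      simp only [h, one_smul, Units.neg_smul] <;> noncomm_ring
  exact LinearMap.congr_fun h b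

theorem exists_f_eq_br (x : E) (b : V.freeLieSpace) :
    ∃ c, S.f.toLinearMap c = L.br x (S.f.toLinearMap b) := by
  refine L.homogeneous_induction
    (p := fun x => L.br x (S.f.toLinearMap b) ∈ LinearMap.range S.f.toLinearMap) x
    (fun i x hx => ?_) fun x y hx hy => by simpa using add_mem hx hy
  refine V.freeLie.homogeneous_induction
    (p := fun b => L.br x (S.f.toLinearMap b) ∈ LinearMap.range S.f.toLinearMap) b
    (fun j b hb => ?_) fun x y hx hy => by simpa using add_mem hx hy
  exact br_swap_mem (S.f_mem_part hb) hx (S.isIdeal _ ⟨b, rfl⟩ x)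

/-- The complement of the free ideal acts by derivations. -/
theorem rho_mul {i j : ℤ} {x : E} (hx : x ∈ S.base) (hxi : x ∈ L.part i)
    {a : TensorAlgebra F M} (ha : a ∈ V.tensorLie.part j) (b : TensorAlgebra F M) :
    S.rho x (a * b) = S.rho x a * b + (i * j).negOnePow • (a * S.rho x b) := by
  let σ := V.tensorLie.signOp i
  let T : Submodule F (TensorAlgebra F M) :=
    { carrier := {a | S.rho x (a * b) = S.rho x a * b + σ a * S.rho x b}
      add_mem' := fun {y z} hy hz => by
        simp only [Set.mem_ofPred_eq, add_mul, map_add] at *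
        rw [hy, hz]
        abel
      zero_mem' := by simp
      smul_mem' := fun c y hy => by
        simp only [Set.mem_ofPred_eq, smul_mul_assoc, map_smul] at *
        rw [hy, smul_add] }
  suffices h : a ∈ T by
    have h' : S.rho x (a * b) = S.rho x a * b + σ a * S.rho x b := h
    rw [h', V.tensorLie.signOp_apply i ha, mul_comm j i, smul_mul_assoc]
  have hone : (1 : TensorAlgebra F M) ∈ V.tensorLie.part 0 := 
    SetLike.GradedOne.one_mem (A := V.tensorPart)
  refine V.mem_of_ι_mul_mem ?_ ?_ a
  · change S.rho x (1 * b) = S.rho x 1 * b + σ 1 * S.rho x b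
    rw [rho_one, S.pr_base hx, V.tensorLie.signOp_apply i hone]
    simp
  · intro m v hv a ha
    have ha' : S.rho x (a * b) = S.rho x a * b + σ a * S.rho x b := ha
    have hv' : TensorAlgebra.ι F v ∈ V.tensorLie.part m := V.ι_mem_tensorPart hv
    have hσ : σ (TensorAlgebra.ι F v * a) = (i * m).negOnePow • (TensorAlgebra.ι F v * σ a) := by
      refine V.tensorLie.homogeneous_induction (p := fun a =>
        σ (TensorAlgebra.ι F v * a) = (i * m).negOnePow • (TensorAlgebra.ι F v * σ a)) a
        (fun k a hak => ?_) fun y z hy hz => by simp only [mul_add, map_add, hy, hz, smul_add]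
      rw [V.tensorLie.signOp_apply i (mul_mem_tensorLie_part hv' hak),
        V.tensorLie.signOp_apply i hak, add_mul, Int.negOnePow_add, mul_smul_comm, mul_comm m i,
        mul_smul]
    obtain ⟨c, hc⟩ := S.exists_f_eq_br x (V.freeLieι v)
    change S.rho x (TensorAlgebra.ι F v * a * b) =
      S.rho x (TensorAlgebra.ι F v * a) * b + σ (TensorAlgebra.ι F v * a) * S.rho x b
    rw [mul_assoc, S.rho_ι_mul hv hxi, S.rho_ι_mul hv hxi, hσ, ha', ← hc, rho_f, rho_f]
    rcases Int.units_eq_one_or (i * m).negOnePow with h | h <;>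
      simp only [h, one_smul, Units.neg_smul] <;> noncomm_ring

/-- On the free ideal, the derivation by which an element `x` of the complement acts is `ad x`. -/
theorem pr_br_f (hV : V.IsConnected) {i : ℤ} {x : E} (hx : x ∈ S.base) (hxi : x ∈ L.part i) (c : V.freeLieSpace) :
    S.pr (L.br x (S.f.toLinearMap c)) = S.rho x c := by
  let T : Submodule F (TensorAlgebra F M) :=
    { carrier := {c | ∃ b : V.freeLieSpace, (b : TensorAlgebra F M) = c ∧
        S.pr (L.br x (S.f.toLinearMap b)) = S.rho x c}
      add_mem' := by
        rintro _ _ ⟨b, rfl, hb⟩ ⟨c, rfl, hc⟩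
        exact ⟨b + c, rfl, by simp only [map_add, hb, hc]⟩
      zero_mem' := ⟨0, rfl, by simp⟩
      smul_mem' := by
        rintro r _ ⟨b, rfl, hb⟩
        exact ⟨r • b, rfl, by simp only [map_smul, hb]⟩ }
  suffices h : V.freeLieSpace ≤ T by
    obtain ⟨b, hb, hb'⟩ := h c.2
    rw [Subtype.ext hb] at hb'
    exact hb'
  -- induction on the dimension: `ad x` and the derivation agree on generators and on brackets
  refine le_of_le_derived_sup_span (s := {c | ∃ m, ∃ v ∈ V.part m, c = TensorAlgebra.ι F v})
    (freeLieSpace_inf_part hV) V.isHomogeneous_freeLieSpace ?_ ?_ ?_ ?_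
  · rintro _ ⟨m, v, hv, rfl⟩
    exact ⟨m, V.ι_mem_tensorPart hv⟩
  · refine V.freeLieSpace_le_derived_sup.trans (sup_le_sup_left ?_ _)
    rintro _ ⟨v, rfl⟩
    refine V.homogeneous_induction (p := fun v => TensorAlgebra.ι F v ∈ Submodule.span F _) v
      (fun m v hv => Submodule.subset_span ⟨m, v, hv, rfl⟩) fun v w hv hw => ?_
    rw [map_add]
    exact add_mem hv hw
  · rintro _ ⟨m, v, hv, rfl⟩
    refine ⟨V.freeLieι v, rfl, ?_⟩
    have h := S.rho_ι_mul hv hxi 1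
    rw [mul_one, rho_one, rho_one, S.pr_base hx, mul_zero, smul_zero, zero_add] at h
    exact h.symm
  · rintro j k _ ⟨haL, a, rfl, ha⟩ haj _ ⟨hbL, b, rfl, hb⟩ hbk
    refine ⟨V.freeLie.br a b, rfl, ?_⟩
    obtain ⟨a', ha'⟩ := S.exists_f_eq_br x a
    obtain ⟨b', hb'⟩ := S.exists_f_eq_br x b
    have hfa := S.f_mem_part haj
    have hfb := S.f_mem_part hbk
    have haj' : (a' : TensorAlgebra F M) ∈ V.tensorLie.part (i + j) :=
      S.f.injective_mem_part S.injective (ha' ▸ L.br_mem hxi hfa)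
    have hbk' : (b' : TensorAlgebra F M) ∈ V.tensorLie.part (i + k) :=
      S.f.injective_mem_part S.injective (hb' ▸ L.br_mem hxi hfb)
    rw [← ha', pr_f] at ha
    rw [← hb', pr_f] at hb
    rw [S.f.map_br, L.jacobi hxi hfa hfb, ← ha', ← hb', ← S.f.map_br, ← S.f.map_br, map_add,
      pr_f, coe_freeLie_br, V.tensorLie_br_apply haj' hbk,
      V.tensorLie_br_apply haj hbk, map_sub, S.rho_mul hx hxi haj, ← ha, ← hb]
    have h1 : S.pr ((i * j).negOnePow • S.f.toLinearMap (V.freeLie.br a b')) =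
        (i * j).negOnePow • (a * b' - (j * (i + k)).negOnePow • (b' * a) : TensorAlgebra F M) := by
      rw [← V.tensorLie_br_apply haj hbk', ← coe_freeLie_br, ← pr_f S]
      rcases Int.units_eq_one_or (i * j).negOnePow with h | h <;> simp [h]
    have h2 : S.rho x ((j * k).negOnePow • (b * a : TensorAlgebra F M)) =
        (j * k).negOnePow • (b' * a + (i * k).negOnePow • (b * a') : TensorAlgebra F M) := by
      rw [hb, ha, ← S.rho_mul hx hxi hbk]
      rcases Int.units_eq_one_or (j * k).negOnePow with h | h <;> simp [h]
    rw [h1, h2, add_mul, mul_add, Int.negOnePow_add, Int.negOnePow_add, mul_comm j i]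
    rcases Int.units_eq_one_or (i * j).negOnePow with h1 | h1 <;>
    rcases Int.units_eq_one_or (i * k).negOnePow with h2 | h2 <;>
    rcases Int.units_eq_one_or (j * k).negOnePow with h3 | h3 <;>
    simp only [h1, h2, h3, one_smul, mul_one, Units.neg_smul, neg_neg, mul_neg] <;>
    noncomm_ring

/-- A homogeneous element is the sum of a homogeneous element of the complement and the image of a
homogeneous element of the free Lie algebra. -/
theorem exists_decomposition {i : ℤ} {x : E} (hx : x ∈ L.part i) :
    ∃ y ∈ S.base, y ∈ L.part i ∧ ∃ b : V.freeLieSpace,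
      (b : TensorAlgebra F M) ∈ V.tensorLie.part i ∧ x = y + S.f.toLinearMap b := by
  obtain ⟨y, hy, _, ⟨b, rfl⟩, hyb⟩ := Submodule.mem_sup.1 (S.isCompl.sup_eq_top ▸ Submodule.mem_top
    : x ∈ S.base ⊔ LinearMap.range S.f.toLinearMap)
  have hb : L.proj i (S.f.toLinearMap b) ∈ LinearMap.range S.f.toLinearMap := by
    refine V.freeLie.homogeneous_induction
      (p := fun b => L.proj i (S.f.toLinearMap b) ∈ LinearMap.range S.f.toLinearMap) b
      (fun j b hb => ?_) fun b c hb hc => by simpa using add_mem hb hc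
    by_cases hij : j = i
    · subst hij
      rw [proj_of_mem (S.f_mem_part hb)]
      exact ⟨b, rfl⟩
    · rw [proj_of_mem_ne hij (S.f_mem_part hb)]
      exact zero_mem _
  obtain ⟨c, hc⟩ := hb
  refine ⟨L.proj i y, S.isHomogeneous_base.proj_mem hy i, proj_mem i y, c, ?_, ?_⟩
  · exact S.f.injective_mem_part S.injective (hc ▸ proj_mem i _)
  · rw [hc, ← map_add, hyb, proj_of_mem hx]

/-- The representation property of `rho` on the generator `1` of the induced module. -/
theorem pr_br (hV : V.IsConnected) {i j : ℤ} {x y : E} (hx : x ∈ L.part i) (hy : y ∈ L.part j) :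
    S.pr (L.br x y) = S.rho x (S.pr y) - (i * j).negOnePow • S.rho y (S.pr x) := by
  obtain ⟨x, hx0, hxi, b, hb, rfl⟩ := S.exists_decomposition hx
  obtain ⟨y, hy0, hyj, c, hc, rfl⟩ := S.exists_decomposition hy
  have hswap : S.pr (L.br (S.f.toLinearMap b) y) = -((i * j).negOnePow • S.rho y b) := by
    rw [L.anticomm (S.f_mem_part hb) hyj, ← S.pr_br_f hV hy0 hyj]
    rcases Int.units_eq_one_or (i * j).negOnePow with h | h <;> simp [h]
  simp only [map_add, LinearMap.add_apply, S.pr_base hx0, S.pr_base hy0, pr_f, zero_add, rho_f]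
  rw [S.pr_base (S.isSubalgebra_base x hx0 y hy0), S.pr_br_f hV hx0 hxi, hswap, ← S.f.map_br, pr_f,
    coe_freeLie_br, V.tensorLie_br_apply hb hc, smul_add]
  abel

/-- `rho` is a representation of the graded Lie algebra `L`. -/
theorem rho_br (hV : V.IsConnected) {i j : ℤ} {x y : E} (hx : x ∈ L.part i) (hy : y ∈ L.part j)
    (a : TensorAlgebra F M) :
    S.rho (L.br x y) a = S.rho x (S.rho y a) - (i * j).negOnePow • S.rho y (S.rho x a) := by
  let T : Submodule F (TensorAlgebra F M) :=
    { carrier := {a | ∀ i j x y, x ∈ L.part i → y ∈ L.part j →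
        S.rho (L.br x y) a = S.rho x (S.rho y a) - (i * j).negOnePow • S.rho y (S.rho x a)}
      add_mem' := fun {a b} ha hb i j x y hx hy => by
        simp only [map_add, ha i j x y hx hy, hb i j x y hx hy, smul_add]
        abel
      zero_mem' := fun i j x y hx hy => by simp
      smul_mem' := fun c a ha i j x y hx hy => by
        simp only [map_smul, ha i j x y hx hy, smul_sub, smul_comm c] }
  suffices h : a ∈ T from h i j x y hx hy
  refine V.mem_of_ι_mul_mem (fun i j x y hx hy => ?_) ?_ a
  · rw [rho_one, rho_one, rho_one, S.pr_br hV hx hy]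
  intro m v hv a ha i j x y hx hy
  set w := S.f.toLinearMap (V.freeLieι v) with hw
  have hwm : w ∈ L.part m := S.f.map_part m _ (V.freeLieι_mem_part hv)
  have hxw := L.br_mem hx hwm
  have hyw := L.br_mem hy hwm
  have hjac : L.br (L.br x y) w = L.br x (L.br y w) - (i * j).negOnePow • L.br y (L.br x w) :=
    eq_sub_of_add_eq (L.jacobi hx hy hwm).symm
  have h1 := ha i (j + m) x (L.br y w) hx hyw
  have h2 := ha j (i + m) y (L.br x w) hy hxw
  have h3 : S.rho ((i * j).negOnePow • L.br y (L.br x w)) a =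
      (i * j).negOnePow • S.rho (L.br y (L.br x w)) a := by
    rcases Int.units_eq_one_or (i * j).negOnePow with h | h <;> simp [h]
  rw [S.rho_ι_mul hv (L.br_mem hx hy), S.rho_ι_mul hv hx, S.rho_ι_mul hv hy, ← hw, hjac, map_sub,
    LinearMap.sub_apply, h1, h3, h2, ha i j x y hx hy, map_add, map_add]
  have h4 : ∀ (u : ℤˣ) (x : E) (a : TensorAlgebra F M), S.rho x (u • a) = u • S.rho x a := by
    intro u x a
    rcases Int.units_eq_one_or u with h | h <;> simp [h]
  rw [h4, h4, S.rho_ι_mul hv hx, S.rho_ι_mul hv hy, ← hw, add_mul, mul_add, mul_add,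
    Int.negOnePow_add, Int.negOnePow_add, Int.negOnePow_add, mul_comm j i]
  rcases Int.units_eq_one_or (i * j).negOnePow with h1 | h1 <;>
  rcases Int.units_eq_one_or (i * m).negOnePow with h2 | h2 <;>
  rcases Int.units_eq_one_or (j * m).negOnePow with h3 | h3 <;>
  simp only [h1, h2, h3, one_smul, mul_one, Units.neg_smul, neg_neg, mul_neg] <;>
  noncomm_ring

end FreeSemidirect

end GrLie

/-! ### Homomorphisms out of a free Lie algebra -/

namespace GrSpace

variable {F : Type*} {M : Type*} [Field F] [AddCommGroup M] [Module F M] (V : GrSpace F M)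

/-- The free Lie algebra is generated by `V`. -/
theorem freeLieSpace_le_of_isSubalgebra {T : Submodule F (TensorAlgebra F M)}
    (h : ∀ v, TensorAlgebra.ι F v ∈ T) (hT : V.tensorLie.IsSubalgebra T) : V.freeLieSpace ≤ T :=
  sInf_le ⟨by rintro _ ⟨v, rfl⟩; exact h v, hT⟩

theorem freeLie_eq_top {T : Submodule F V.freeLieSpace} (h : ∀ v, V.freeLieι v ∈ T)
    (hT : V.freeLie.IsSubalgebra T) : T = ⊤ := by
  have h1 : V.freeLieSpace ≤ T.map V.freeLieSpace.subtype := by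
    refine V.freeLieSpace_le_of_isSubalgebra (fun v => ⟨_, h v, rfl⟩) ?_
    rintro _ ⟨a, ha, rfl⟩ _ ⟨b, hb, rfl⟩
    exact ⟨_, hT a ha b hb, rfl⟩
  refine eq_top_iff.2 fun x _ => ?_
  obtain ⟨y, hy, hyx⟩ := h1 x.2
  rwa [Subtype.ext hyx] at hy

end GrSpace

namespace GrLie

open GrSpace

variable {F E M W : Type*} [Field F] [AddCommGroup E] [Module F E] [AddCommGroup M] [Module F M]
  [AddCommGroup W] [Module F W] {L : GrLie F E} {V : GrSpace F M}

/-- A sum of subspaces is a subalgebra if it contains the brackets of elements of the summands. -/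
theorem isSubalgebra_iSup {ι : Sort*} {Q : ι → Submodule F E}
    (h : ∀ i j, ∀ x ∈ Q i, ∀ y ∈ Q j, L.br x y ∈ ⨆ k, Q k) : L.IsSubalgebra (⨆ k, Q k) := by
  intro x hx y hy
  refine Submodule.iSup_induction Q (motive := fun x => L.br x y ∈ ⨆ k, Q k) hx ?_ (by simp)
    fun a b ha hb => by simpa using add_mem ha hb
  intro i x hx
  exact Submodule.iSup_induction Q (motive := fun y => L.br x y ∈ ⨆ k, Q k) hy
    (fun j y hy => h i j x hx y hy) (by simp) fun a b ha hb => by simpa using add_mem ha hb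

/-- `rho` is faithful on subspaces that do not meet the complement of the free ideal, because
`rho x 1 = pr x`. -/
theorem FreeSemidirect.rho_injOn (S : FreeSemidirect L V) {J : Submodule F E}
    (hJ0 : J ⊓ S.base = ⊥) : Function.Injective (S.rho ∘ₗ J.subtype) := by
  rw [injective_iff_map_eq_zero]
  intro y hy
  have h1 : S.pr y = 0 := by
    rw [← S.rho_one]
    exact LinearMap.congr_fun hy 1
  have h2 : (y : E) ∈ J ⊓ S.base := ⟨y.2, S.mem_base_of_pr_eq_zero h1⟩
  rw [hJ0, Submodule.mem_bot] at h2
  exact Subtype.ext h2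

/-- The universal property of free Lie algebras, for maps to a subalgebra on which the
representation `rho` in an associative algebra is faithful. -/
theorem FreeSemidirect.exists_hom (S : FreeSemidirect L V) (hV : V.IsConnected)
    {J : Submodule F E} (hJ : L.IsSubalgebra J) (hJg : L.IsHomogeneous J)
    (hJ0 : J ⊓ S.base = ⊥) (X : GrSpace F W) (u : W →ₗ[F] E)
    (hu : ∀ n, ∀ v ∈ X.part n, u v ∈ J ∧ u v ∈ L.part n) :
    ∃ g : Hom X.freeLie (L.restrict J hJ hJg),
      (∀ v, (g.toLinearMap (X.freeLieι v) : E) = u v) ∧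
      ∀ z, S.rho (g.toLinearMap z) = TensorAlgebra.lift F (S.rho ∘ₗ u) z := by
  set Φ := TensorAlgebra.lift F (S.rho ∘ₗ u) with hΦ
  have hinj := S.rho_injOn hJ0
  have hbr : ∀ n m, ∀ z ∈ X.tensorLie.part n, ∀ z' ∈ X.tensorLie.part m,
      ∀ y ∈ L.part n, ∀ y' ∈ L.part m, Φ z = S.rho y → Φ z' = S.rho y' →
      Φ (X.tensorLie.br z z') = S.rho (L.br y y') := by
    intro n m z hz z' hz' y hy y' hy' h h'
    refine LinearMap.ext fun a => ?_
    rw [S.rho_br hV hy hy', X.tensorLie_br_apply hz hz', map_sub, map_mul, h, h']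
    have h1 : Φ ((n * m).negOnePow • (z' * z)) =
        (n * m).negOnePow • (S.rho y' * S.rho y) := by
      rw [← h, ← h', ← map_mul]
      rcases Int.units_eq_one_or (n * m).negOnePow with h | h <;> simp [h]
    rw [h1]
    rcases Int.units_eq_one_or (n * m).negOnePow with h | h <;> simp [h]
  let Q : ℤ → Submodule F (TensorAlgebra F W) := fun n =>
    X.tensorLie.part n ⊓ ((J ⊓ L.part n).map S.rho).comap Φ.toLinearMap
  have hQ : X.freeLieSpace ≤ ⨆ n, Q n := by
    refine X.freeLieSpace_le_of_isSubalgebra (fun v => ?_) (isSubalgebra_iSup ?_)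
    · refine X.homogeneous_induction (p := fun v => TensorAlgebra.ι F v ∈ ⨆ n, Q n) v
        (fun n v hv => ?_) fun v w hv hw => by rw [map_add]; exact add_mem hv hw
      exact Submodule.mem_iSup_of_mem n ⟨X.ι_mem_tensorPart hv, u v, hu n v hv, by simp [hΦ]⟩
    · rintro n m z ⟨hz, y, ⟨hyJ, hy⟩, hzy⟩ z' ⟨hz', y', ⟨hyJ', hy'⟩, hzy'⟩
      exact Submodule.mem_iSup_of_mem (n + m) ⟨X.tensorLie.br_mem hz hz', L.br y y',
        ⟨hJ y hyJ y' hyJ', L.br_mem hy hy'⟩,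
        (hbr n m z hz z' hz' y hy y' hy' hzy.symm hzy'.symm).symm⟩
  have hrange : ∀ z : X.freeLieSpace, Φ z ∈ LinearMap.range (S.rho ∘ₗ J.subtype) := by
    intro z
    have h1 : (⨆ n, Q n) ≤ (LinearMap.range (S.rho ∘ₗ J.subtype)).comap Φ.toLinearMap := by
      refine iSup_le fun n z hz => ?_
      obtain ⟨-, y, ⟨hyJ, -⟩, hzy⟩ := hz
      exact ⟨⟨y, hyJ⟩, hzy⟩
    exact h1 (hQ z.2)
  let g : X.freeLieSpace →ₗ[F] J := (LinearEquiv.ofInjective _ hinj).symm.toLinearMap ∘ₗ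
    (Φ.toLinearMap ∘ₗ X.freeLieSpace.subtype).codRestrict _ hrange
  have hg : ∀ z, S.rho (g z) = Φ z := by
    intro z
    have h1 := LinearEquiv.ofInjective_apply (h := hinj) (S.rho ∘ₗ J.subtype) (g z)
    have h2 : LinearEquiv.ofInjective _ hinj (g z) = ⟨Φ z, hrange z⟩ :=
      LinearEquiv.apply_symm_apply _ _
    rw [h2] at h1
    exact h1.symm
  have hguniq : ∀ (z : X.freeLieSpace) (y : J), Φ z = S.rho y → g z = y := fun z y h =>
    hinj ((hg z).trans h)
  have hgpart : ∀ n, ∀ z ∈ X.freeLie.part n, (g z : E) ∈ L.part n := by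
    intro n z hz
    obtain ⟨-, y, ⟨hyJ, hy⟩, hzy⟩ :=
      mem_of_mem_iSup_of_mem_part (V := X.tensorLie.toGrSpace) (fun _ => inf_le_left) (hQ z.2) hz
    rw [hguniq z ⟨y, hyJ⟩ hzy.symm]
    exact hy
  refine ⟨⟨g, hgpart, ?_⟩, fun v => ?_, hg⟩
  · intro z z'
    refine X.freeLie.homogeneous_induction (p := fun z => g (X.freeLie.br z z') =
      (L.restrict J hJ hJg).br (g z) (g z')) z (fun n z hz => ?_) fun a b ha hb => by
        simp only [map_add, LinearMap.add_apply, ha, hb]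
    refine X.freeLie.homogeneous_induction (p := fun z' => g (X.freeLie.br z z') =
      (L.restrict J hJ hJg).br (g z) (g z')) z' (fun m z' hz' => ?_) fun a b ha hb => by
        simp only [map_add, ha, hb]
    exact hguniq (X.freeLie.br z z') ((L.restrict J hJ hJg).br (g z) (g z')) (hbr n m z hz z' hz' _ (hgpart n z hz) _ (hgpart m z' hz') (hg z).symm
      (hg z').symm)
  · have huJ : u v ∈ J := X.homogeneous_induction (p := fun v => u v ∈ J) v
      (fun n v hv => (hu n v hv).1) fun a b ha hb => by rw [map_add]; exact add_mem ha hb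
    exact congrArg Subtype.val (hguniq (X.freeLieι v) ⟨u v, huJ⟩ (by simp [hΦ, coe_freeLieι]))

end GrLie

/-! ### The degree filtration -/

namespace BigrLie

open GrSpace

variable {F : Type u} {E : Type v} [Field F] [AddCommGroup E] [Module F E] (L : BigrLie F E)

theorem bipart_le_part (i j : ℤ) : L.bipart i j ≤ L.part i :=
  L.part_eq i ▸ le_iSup (L.bipart i) j

theorem bipart_le_degreePart (i j : ℤ) : L.bipart i j ≤ L.degreePart j :=
  le_iSup (fun i => L.bipart i j) i

/-- The grading by degree. -/
def degreeGrading : GrSpace F E where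
  part := L.degreePart
  isInternal := by
    refine DirectSum.isInternal_of_projections (fun j => L.isInternal_bipart.glue fun k =>
      if k.2 = j then (L.bipart k.1 k.2).subtype else 0) ?_ ?_ ?_
    · have h := L.isInternal_bipart.submodule_iSup_eq_top
      rw [eq_top_iff, ← h]
      exact iSup_le fun p => (L.bipart_le_degreePart p.1 p.2).trans (le_iSup L.degreePart p.2)
    · intro j x hx
      refine Submodule.iSup_induction _ (motive := fun x => _ = x) hx (fun i x hx => ?_) (by simp)
        fun a b ha hb => by rw [map_add, ha, hb]
      rw [L.isInternal_bipart.glue_apply _ (k := (i, j)) hx]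
      simp
    · intro j l hlj x hx
      refine Submodule.iSup_induction _ (motive := fun x => _ = (0 : E)) hx (fun i x hx => ?_)
        (by simp) fun a b ha hb => by rw [map_add, ha, hb, add_zero]
      rw [L.isInternal_bipart.glue_apply _ (k := (i, l)) hx]
      simp [hlj]

theorem degree_proj_mem_bipart {i : ℤ} {x : E} (hx : x ∈ L.part i) (j : ℤ) :
    L.degreeGrading.proj j x ∈ L.bipart i j :=
  proj_mem_of_mem_iSup (V := L.degreeGrading) (L.bipart_le_degreePart i) (L.part_eq i ▸ hx) j

theorem br_mem_degreePart {j l : ℤ} {x y : E} (hx : x ∈ L.degreePart j)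
    (hy : y ∈ L.degreePart l) : L.br x y ∈ L.degreePart (j + l) := by
  refine Submodule.iSup_induction _ (motive := fun x => L.br x y ∈ L.degreePart (j + l)) hx ?_
    (by simp) fun a b ha hb => by simpa using add_mem ha hb
  intro i x hx
  refine Submodule.iSup_induction _ (motive := fun y => L.br x y ∈ L.degreePart (j + l)) hy ?_
    (by simp) fun a b ha hb => by simpa using add_mem ha hb
  intro k y hy
  exact L.bipart_le_degreePart _ _ (L.br_mem_bipart hx hy)

/-- The sum of the components of degree less than `j`. -/
def below (j : ℤ) : Submodule F E := ⨆ k : Set.Iio j, L.degreePart k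

variable {L}

theorem degreePart_le_below {j k : ℤ} (h : k < j) : L.degreePart k ≤ L.below j :=
  le_iSup (fun k : Set.Iio j => L.degreePart k) ⟨k, h⟩

theorem below_mono {j k : ℤ} (h : j ≤ k) : L.below j ≤ L.below k :=
  iSup_le fun l => degreePart_le_below (lt_of_lt_of_le l.2 h)

theorem proj_of_mem_below {j k : ℤ} (h : j ≤ k) {x : E} (hx : x ∈ L.below j) :
    L.degreeGrading.proj k x = 0 := by
  have h1 : L.below j ≤ LinearMap.ker (L.degreeGrading.proj k) :=
    iSup_le fun l x hx => proj_of_mem_ne (V := L.degreeGrading)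
      (by have := l.2; simp only [Set.mem_Iio] at this; omega) hx
  exact h1 hx

theorem sub_proj_mem_below {j : ℤ} {x : E} (hx : x ∈ L.below (j + 1)) :
    x - L.degreeGrading.proj j x ∈ L.below j := by
  have h1 : L.below (j + 1) ≤ (L.below j).comap (LinearMap.id - L.degreeGrading.proj j) := by
    refine iSup_le fun l x hx => ?_
    have hl := l.2
    simp only [Set.mem_Iio] at hl
    simp only [Submodule.mem_comap, LinearMap.sub_apply, LinearMap.id_apply]
    by_cases h : (l : ℤ) = j
    · rw [h] at hx
      rw [proj_of_mem (V := L.degreeGrading) hx, sub_self]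
      exact zero_mem _
    · rw [proj_of_mem_ne (V := L.degreeGrading) h hx, sub_zero]
      exact degreePart_le_below (by omega) hx
  exact h1 hx

theorem br_mem_below {j k l : ℤ} (h : j + k ≤ l + 1) {x y : E} (hx : x ∈ L.below j)
    (hy : y ∈ L.below k) : L.br x y ∈ L.below l := by
  refine Submodule.iSup_induction _ (motive := fun x => L.br x y ∈ L.below l) hx ?_
    (by simp) fun a b ha hb => by simpa using add_mem ha hb
  intro a x hx
  refine Submodule.iSup_induction _ (motive := fun y => L.br x y ∈ L.below l) hy ?_
    (by simp) fun a b ha hb => by simpa using add_mem ha hb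
  intro b y hy
  have ha := a.2
  have hb := b.2
  simp only [Set.mem_Iio] at ha hb
  exact degreePart_le_below (by omega) (L.br_mem_degreePart hx hy)

theorem exists_mem_below (x : E) : ∃ N : ℕ, x ∈ L.below N := by
  refine L.degreeGrading.homogeneous_induction (p := fun x => ∃ N : ℕ, x ∈ L.below N) x
    (fun n x hx => ⟨(n + 1).toNat, degreePart_le_below (by omega) hx⟩) ?_
  rintro x y ⟨M, hM⟩ ⟨N, hN⟩
  exact ⟨max M N, add_mem (below_mono (by simp) hM) (below_mono (by simp) hN)⟩

theorem isHomogeneous_below (j : ℤ) : L.IsHomogeneous (L.below j) :=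
  isHomogeneous_iSup fun k => L.isHomogeneous_degreePart k

/-- If leading terms multiply, so do elements up to lower degree terms. -/
theorem br_sub_br_mem_below {j l : ℤ} {s t x y : E} (hs : s ∈ L.degreePart j)
    (ht : t ∈ L.degreePart l) (hx : x - s ∈ L.below j) (hy : y - t ∈ L.below l) :
    L.br x y - L.br s t ∈ L.below (j + l) := by
  have h : L.br x y - L.br s t = L.br (x - s) y + L.br s (y - t) := by
    simp only [map_sub, LinearMap.sub_apply]
    abel
  have hy' : y ∈ L.below (l + 1) := by
    have := add_mem (below_mono (by omega) hy) (degreePart_le_below (by omega : l < l + 1) ht)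
    rwa [sub_add_cancel] at this
  rw [h]
  exact add_mem (br_mem_below (by omega) hx hy')
    (br_mem_below (by omega) (degreePart_le_below (by omega : j < j + 1) hs) hy)

end BigrLie

/-! ### The associated graded subalgebra -/

namespace BigrLie

open GrSpace GrLie

variable {F : Type u} {E : Type v} [Field F] [AddCommGroup E] [Module F E] {L : BigrLie F E}

/-- The elements of degree `j` and dimension `i` that are the components of degree `j` of elements
of `J` without components of higher degree. -/
def topForms (L : BigrLie F E) (J : Submodule F E) (i j : ℤ) : Submodule F E :=
  L.bipart i j ⊓ (J ⊓ L.part i ⊔ L.below j)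

/-- The associated graded subspace of `J` for the filtration of `L` by degree. -/
def topFormSpace (L : BigrLie F E) (J : Submodule F E) : Submodule F E :=
  ⨆ p : ℤ × ℤ, L.topForms J p.1 p.2

variable {J : Submodule F E}

theorem mem_topForms {i j : ℤ} {t : E} : t ∈ L.topForms J i j ↔
    t ∈ L.bipart i j ∧ ∃ y ∈ J, y ∈ L.part i ∧ y - t ∈ L.below j := by
  constructor
  · rintro ⟨ht, h⟩
    obtain ⟨y, hy, z, hz, rfl⟩ := Submodule.mem_sup.1 h
    exact ⟨ht, y, hy.1, hy.2, by simpa using neg_mem hz⟩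
  · rintro ⟨ht, y, hyJ, hy, hz⟩
    exact ⟨ht, Submodule.mem_sup.2 ⟨y, ⟨hyJ, hy⟩, t - y, by simpa using neg_mem hz, by simp⟩⟩

theorem isHomogeneous_topFormSpace : L.IsHomogeneous (L.topFormSpace J) :=
  isHomogeneous_iSup fun p =>
    isHomogeneous_of_le_part (inf_le_left.trans (L.bipart_le_part p.1 p.2))

theorem isSubalgebra_topFormSpace (hJ : L.IsSubalgebra J) :
    L.IsSubalgebra (L.topFormSpace J) := by
  refine isSubalgebra_iSup ?_
  rintro ⟨i, j⟩ ⟨k, l⟩ s hs t ht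
  obtain ⟨hs, x, hxJ, hxi, hxs⟩ := mem_topForms.1 hs
  obtain ⟨ht, y, hyJ, hyk, hyt⟩ := mem_topForms.1 ht
  refine Submodule.mem_iSup_of_mem (i + k, j + l) (mem_topForms.2
    ⟨L.br_mem_bipart hs ht, L.br x y, hJ x hxJ y hyJ, L.br_mem hxi hyk, ?_⟩)
  exact br_sub_br_mem_below (L.bipart_le_degreePart _ _ hs) (L.bipart_le_degreePart _ _ ht) hxs hyt

/-! ### Degrees in a semidirect product with a free Lie algebra -/

/-- A bigraded semidirect product `L₀ ⋊ 𝕃L₁` as a semidirect product of graded Lie algebras. -/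
theorem IsSemidirectFree.exists_freeSemidirect (hL : L.IsSemidirectFree) :
    ∃ S : FreeSemidirect L.toGrLie (L.degreeSpace 1), S.base = L.degreePart 0 ∧
      ∀ v, S.f.toLinearMap ((L.degreeSpace 1).freeLieι v) = v := by
  obtain ⟨hsub, f, hι, hinj, hideal, hcompl⟩ := hL
  exact ⟨⟨L.degreePart 0, hsub, L.isHomogeneous_degreePart 0, f, hinj, hideal, hcompl⟩, rfl, hι⟩

variable (S : FreeSemidirect L.toGrLie (L.degreeSpace 1))
  (hι : ∀ v, S.f.toLinearMap ((L.degreeSpace 1).freeLieι v) = v)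

include hι in
theorem proj_f_eq_zero {j : ℤ} (hj : j < 1) (b : (L.degreeSpace 1).freeLieSpace) :
    L.degreeGrading.proj j (S.f.toLinearMap b) = 0 := by
  let T : Submodule F E := ⨆ k : Set.Ici (1 : ℤ), L.degreePart k
  have hT : L.IsSubalgebra T := by
    refine isSubalgebra_iSup ?_
    rintro ⟨k, hk⟩ ⟨l, hl⟩ x hx y hy
    simp only [Set.mem_Ici] at hk hl
    exact Submodule.mem_iSup_of_mem (⟨k + l, by simp only [Set.mem_Ici]; omega⟩ : Set.Ici (1 : ℤ))
      (L.br_mem_degreePart hx hy)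
  have htop : T.comap S.f.toLinearMap = ⊤ := by
    refine (L.degreeSpace 1).freeLie_eq_top (fun v => ?_) fun x hx y hy => ?_
    · rw [Submodule.mem_comap, hι]
      exact Submodule.mem_iSup_of_mem (⟨1, Set.mem_Ici.2 le_rfl⟩ : Set.Ici (1 : ℤ)) v.2
    · rw [Submodule.mem_comap, S.f.map_br]
      exact hT _ hx _ hy
  have hle : T ≤ LinearMap.ker (L.degreeGrading.proj j) := iSup_le fun k x hx =>
    proj_of_mem_ne (V := L.degreeGrading)
      (by have := k.2; simp only [Set.mem_Ici] at this; omega) hx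
  exact hle (htop ▸ Submodule.mem_top : b ∈ T.comap S.f.toLinearMap)

variable (hbase : S.base = L.degreePart 0)

include hι hbase in
/-- The components of nonzero degree lie in the free ideal. -/
theorem degreePart_le_range {j : ℤ} (hj : j ≠ 0) :
    L.degreePart j ≤ LinearMap.range S.f.toLinearMap := by
  intro x hx
  obtain ⟨y, hy, _, ⟨b, rfl⟩, rfl⟩ := Submodule.mem_sup.1
    (S.isCompl.sup_eq_top ▸ Submodule.mem_top : x ∈ S.base ⊔ LinearMap.range S.f.toLinearMap)
  rw [hbase] at hy
  have h1 := proj_of_mem_ne (V := L.degreeGrading) (n := 0) hj hx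
  rw [map_add, proj_f_eq_zero S hι (by omega), add_zero,
    proj_of_mem (V := L.degreeGrading) hy] at h1
  rw [h1, zero_add]
  exact ⟨b, rfl⟩

include hι hbase in
theorem degreePart_eq_bot {j : ℤ} (hj : j < 0) : L.degreePart j = ⊥ := by
  rw [eq_bot_iff]
  intro x hx
  obtain ⟨b, rfl⟩ := degreePart_le_range S hι hbase hj.ne hx
  rw [Submodule.mem_bot, ← proj_of_mem (V := L.degreeGrading) hx,
    proj_f_eq_zero S hι (by omega)]

include hι hbase in
theorem below_one_le : L.below 1 ≤ L.degreePart 0 := by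
  refine iSup_le fun k => ?_
  have hk := k.2
  simp only [Set.mem_Iio] at hk
  rcases (show (k : ℤ) ≤ 0 by omega).lt_or_eq with h | h
  · rw [degreePart_eq_bot S hι hbase h]
    exact bot_le
  · rw [h]

variable (hJ0 : J ⊓ L.degreePart 0 = ⊥)

include hι hbase hJ0 in
theorem eq_zero_of_mem_below_one {y : E} (hy : y ∈ J) (hy1 : y ∈ L.below 1) : y = 0 := by
  have h : y ∈ J ⊓ L.degreePart 0 := ⟨hy, below_one_le S hι hbase hy1⟩
  rwa [hJ0, Submodule.mem_bot] at h

include hι hbase hJ0 in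
/-- Since `J` does not meet `L₀`, the top degree forms of its elements lie in the free ideal. -/
theorem topFormSpace_le_range : L.topFormSpace J ≤ LinearMap.range S.f.toLinearMap := by
  refine iSup_le ?_
  rintro ⟨i, j⟩ t ht
  obtain ⟨htb, y, hyJ, -, hyt⟩ := mem_topForms.1 ht
  have htj := L.bipart_le_degreePart _ _ htb
  by_cases hj : 1 ≤ j
  · exact degreePart_le_range S hι hbase (by omega) htj
  · have hy1 : y ∈ L.below 1 := by
      have h1 := add_mem (below_mono (show j ≤ 1 by omega) hyt)
        (degreePart_le_below (show j < 1 by omega) htj)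
      rwa [sub_add_cancel] at h1
    have hy0 := eq_zero_of_mem_below_one S hι hbase hJ0 hyJ hy1
    rw [hy0, zero_sub] at hyt
    have h1 := proj_of_mem_below le_rfl hyt
    rw [map_neg, proj_of_mem (V := L.degreeGrading) htj, neg_eq_zero] at h1
    change t ∈ _
    rw [h1]
    exact zero_mem _

end BigrLie

/-! ### Freeness from the associated graded subalgebra -/

namespace BigrLie

open GrSpace GrLie

variable {F : Type u} {E : Type v} [Field F] [AddCommGroup E] [Module F E] {L : BigrLie F E}

theorem isConnected_degreeSpace (hconn : L.IsConnected) (j : ℤ) :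
    (L.degreeSpace j).IsConnected := by
  intro i hi
  rw [eq_bot_iff]
  intro x hx
  have h : (x : E) ∈ L.part i := hx
  rw [hconn i hi, Submodule.mem_bot] at h
  exact (Submodule.mem_bot F).2 (Subtype.ext h)

variable {M : Type*} [AddCommGroup M] [Module F M] {V : GrSpace F M}

theorem finiteDimensional_freeLieSpace (hft : L.IsFiniteType) (S : FreeSemidirect L.toGrLie V)
    (n : ℤ) :
    FiniteDimensional F (V.freeLieSpace ⊓ V.tensorLie.part n : Submodule F _) := by
  have := hft n
  let φ : (V.freeLieSpace ⊓ V.tensorLie.part n : Submodule F _) →ₗ[F] L.part n :=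
    (S.f.toLinearMap ∘ₗ Submodule.inclusion inf_le_left).codRestrict _
      fun x => S.f_mem_part x.2.2
  refine FiniteDimensional.of_injective φ fun x y hxy => ?_
  exact Submodule.inclusion_injective _ (S.injective (congrArg Subtype.val hxy))

/-- Elements of a graded subalgebra `G` of the free ideal that are linearly independent modulo the
brackets of `G` correspond to left independent elements of the tensor algebra. -/
theorem linearIndependent_of_le_range (h2 : (2 : F) ≠ 0) (hft : L.IsFiniteType)
    (hV : V.IsConnected) (S : FreeSemidirect L.toGrLie V) {G : Submodule F E}
    (hG : L.IsSubalgebra G) (hGh : L.IsHomogeneous G)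
    (hGle : G ≤ LinearMap.range S.f.toLinearMap) {I : Type*} {w : I → V.freeLieSpace}
    (hw : ∀ i, S.f.toLinearMap (w i) ∈ G)
    (hli : LinearIndependent F ((L.derived G).mkQ ∘ fun i => S.f.toLinearMap (w i))) :
    LinearIndependent (TensorAlgebra F M) fun i => (w i : TensorAlgebra F M) := by
  let K : Submodule F (TensorAlgebra F M) :=
    (G.comap S.f.toLinearMap).map V.freeLieSpace.subtype
  have hKh : V.tensorLie.IsHomogeneous K := by
    rintro _ ⟨b, hb, rfl⟩
    have H : ∀ t ∈ G, ∃ b : V.freeLieSpace, S.f.toLinearMap b = t ∧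
        (b : TensorAlgebra F M) ∈ ⨆ n, K ⊓ V.tensorLie.part n := by
      intro t ht
      refine hGh.induction (p := fun t => ∃ b : V.freeLieSpace, S.f.toLinearMap b = t ∧
        (b : TensorAlgebra F M) ∈ ⨆ n, K ⊓ V.tensorLie.part n) ht (fun n t ht hn => ?_) ?_
      · obtain ⟨b, rfl⟩ := hGle ht
        exact ⟨b, rfl, Submodule.mem_iSup_of_mem n
          ⟨⟨b, ht, rfl⟩, S.f.injective_mem_part S.injective hn⟩⟩
      · rintro _ _ ⟨b, rfl, hb⟩ ⟨c, rfl, hc⟩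
        exact ⟨b + c, map_add _ _ _, add_mem hb hc⟩
    obtain ⟨c, hc, hc'⟩ := H _ hb
    rwa [S.injective hc] at hc'
  have hKs : V.tensorLie.IsSubalgebra K := by
    rintro _ ⟨b, hb, rfl⟩ _ ⟨c, hc, rfl⟩
    refine ⟨V.freeLie.br b c, ?_, rfl⟩
    change S.f.toLinearMap (V.freeLie.br b c) ∈ G
    rw [S.f.map_br]
    exact hG _ hb _ hc
  have hKL : K ≤ V.freeLieSpace := Submodule.map_subtype_le _ _
  have ht := isTight_of_le_freeLieSpace hV h2 (finiteDimensional_freeLieSpace hft S) hKh hKs hKL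
  refine ht.linearIndependent (fun i => ⟨w i, hw i, rfl⟩) fun c hc => ?_
  have hD : V.tensorLie.derived K ≤
      ((L.derived G).comap S.f.toLinearMap).map V.freeLieSpace.subtype := by
    refine Submodule.map₂_le.2 ?_
    rintro _ ⟨a, ha, rfl⟩ _ ⟨b, hb, rfl⟩
    refine ⟨V.freeLie.br a b, ?_, rfl⟩
    change S.f.toLinearMap (V.freeLie.br a b) ∈ L.derived G
    rw [S.f.map_br]
    exact br_mem_derived ha hb
  obtain ⟨b, hb, hbc⟩ := hD hc
  have hb' : b = Finsupp.linearCombination F w c := by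
    exact Subtype.ext (hbc.trans
      (Finsupp.apply_linearCombination F V.freeLieSpace.subtype w c).symm)
  refine linearIndependent_iff.1 hli c ?_
  rw [← Finsupp.apply_linearCombination]
  have h1 : Finsupp.linearCombination F (fun i => S.f.toLinearMap (w i)) c =
      S.f.toLinearMap b := by
    rw [hb', Finsupp.apply_linearCombination]
    rfl
  rw [h1]
  simpa using hb

/-- Comparison of a homomorphism `g` to `J` with a homomorphism `a` that carries the top degree
parts of the values of `g`: if `a` is an isomorphism onto the associated graded subalgebra of `J`,
then `g` is an isomorphism. -/
theorem bijective_of_top_degree {W : Type*} [AddCommGroup W] [Module F W] {X : GrSpace F W}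
    {J : Submodule F E} (hJ : L.IsSubalgebra J) (hJg : L.IsHomogeneous J)
    (hJ1 : ∀ y ∈ J, y ∈ L.below 1 → y = 0)
    (a : Hom X.freeLie L.toGrLie) (ha : Function.Injective a.toLinearMap)
    (haG : L.topFormSpace J ≤ LinearMap.range a.toLinearMap)
    (g : Hom X.freeLie (L.restrict J hJ hJg))
    (hX : LinearMap.range X.freeLieι ≤ ⨆ j, (L.degreePart j).comap a.toLinearMap ⊓
      (L.below j).comap (J.subtype ∘ₗ g.toLinearMap - a.toLinearMap)) :
    Function.Bijective g.toLinearMap := by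
  let Q : ℤ → Submodule F X.freeLieSpace := fun j => (L.degreePart j).comap a.toLinearMap ⊓
    (L.below j).comap (J.subtype ∘ₗ g.toLinearMap - a.toLinearMap)
  have hQ : ∀ {j z}, z ∈ Q j → a.toLinearMap z ∈ L.degreePart j ∧
      (g.toLinearMap z : E) - a.toLinearMap z ∈ L.below j := fun h => h
  have htop : ⨆ j, Q j = ⊤ := by
    refine X.freeLie_eq_top (fun v => hX ⟨v, rfl⟩) (isSubalgebra_iSup ?_)
    intro j l z hz z' hz'
    refine Submodule.mem_iSup_of_mem (j + l) ⟨?_, ?_⟩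
    · change a.toLinearMap (X.freeLie.br z z') ∈ L.degreePart (j + l)
      rw [a.map_br]
      exact L.br_mem_degreePart hz.1 hz'.1
    · change (g.toLinearMap (X.freeLie.br z z') : E) -
        a.toLinearMap (X.freeLie.br z z') ∈ L.below (j + l)
      rw [a.map_br, g.map_br]
      exact br_sub_br_mem_below hz.1 hz'.1 (hQ hz).2 (hQ hz').2
  have hdec : ∀ z, ∃ c : ℤ →₀ X.freeLieSpace, (∀ j, c j ∈ Q j) ∧ (c.sum fun _ x => x) = z := by
    intro z
    exact (Submodule.mem_iSup_iff_exists_finsupp Q z).1 (htop ▸ Submodule.mem_top)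
  refine ⟨(injective_iff_map_eq_zero _).2 fun z hz => ?_, fun y => ?_⟩
  · obtain ⟨c, hc, rfl⟩ := hdec z
    by_contra h0
    have hne : c.support.Nonempty := by
      rw [Finset.nonempty_iff_ne_empty, Ne, Finsupp.support_eq_empty]
      rintro rfl
      simp at h0
    -- the component of top degree `m` of `g z` is `a (c m)`
    set m := c.support.max' hne with hm
    have hmc : m ∈ c.support := Finset.max'_mem _ _
    have h1 : ∀ j ∈ c.support, L.degreeGrading.proj m (g.toLinearMap (c j) : E) =
        L.degreeGrading.proj m (a.toLinearMap (c j)) := by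
      intro j hj
      rw [← sub_eq_zero, ← map_sub]
      exact proj_of_mem_below (Finset.le_max' _ _ hj) (hQ (hc j)).2
    have h2 : L.degreeGrading.proj m (g.toLinearMap (c.sum fun _ x => x) : E) =
        a.toLinearMap (c m) := by
      have h3 : (g.toLinearMap (c.sum fun _ x => x) : E) =
          ∑ j ∈ c.support, (g.toLinearMap (c j) : E) := by
        rw [Finsupp.sum, map_sum, Submodule.coe_sum]
      rw [h3, map_sum, Finset.sum_congr rfl h1, Finset.sum_eq_single m]
      · exact proj_of_mem (V := L.degreeGrading) (hQ (hc m)).1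
      · exact fun j _ hj => proj_of_mem_ne (V := L.degreeGrading) hj (hQ (hc j)).1
      · exact fun h => absurd hmc h
    rw [hz, ZeroMemClass.coe_zero, map_zero] at h2
    exact (Finsupp.mem_support_iff.1 hmc) (ha (by rw [← h2, map_zero]))
  · let R : Submodule F E := LinearMap.range (J.subtype ∘ₗ g.toLinearMap)
    suffices H : ∀ m : ℕ, ∀ y ∈ J, y ∈ L.below (m + 1) → y ∈ R by
      obtain ⟨N, hN⟩ := exists_mem_below (L := L) (y : E)
      obtain ⟨z, hz⟩ := H N y y.2 (below_mono (by omega) hN)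
      exact ⟨z, Subtype.ext hz⟩
    intro m
    induction m with
    | zero =>
      intro y hy hy1
      rw [hJ1 y hy (by simpa using hy1)]
      exact zero_mem _
    | succ m ih =>
      intro y hy hym
      refine mem_of_proj_mem (V := L.toGrSpace) fun n => ?_
      have hynJ := hJg.proj_mem hy n
      have hynb := (isHomogeneous_below (L := L) _).proj_mem hym n
      have hyn := proj_mem (V := L.toGrSpace) n y
      generalize L.toGrSpace.proj n y = y at hynJ hynb hyn
      -- subtract an element of the range with the same top form
      have hlow := sub_proj_mem_below hynb
      have htb := L.degree_proj_mem_bipart hyn ((m + 1 : ℕ) : ℤ)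
      set t := L.degreeGrading.proj ((m + 1 : ℕ) : ℤ) y with ht
      have htG : t ∈ L.topFormSpace J := Submodule.mem_iSup_of_mem (n, ((m + 1 : ℕ) : ℤ))
        (mem_topForms.2 ⟨htb, y, hynJ, hyn, hlow⟩)
      obtain ⟨z, hz⟩ := haG htG
      have hzQ : z ∈ Q ((m + 1 : ℕ) : ℤ) := by
        obtain ⟨c, hc, rfl⟩ := hdec z
        have hproj : ∀ k, L.degreeGrading.proj k t = a.toLinearMap (c k) := by
          intro k
          rw [← hz, Finsupp.sum, map_sum, map_sum, Finset.sum_eq_single k]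
          · exact proj_of_mem (V := L.degreeGrading) (hQ (hc k)).1
          · exact fun j _ hj => proj_of_mem_ne (V := L.degreeGrading) hj (hQ (hc j)).1
          · intro h
            rw [Finsupp.notMem_support_iff.1 h, map_zero, map_zero]
        refine Submodule.sum_mem _ fun k _ => ?_
        by_cases hk : k = ((m + 1 : ℕ) : ℤ)
        · rw [← hk]
          exact hc k
        · have h1 : a.toLinearMap (c k) = 0 := by
            rw [← hproj, proj_of_mem_ne (V := L.degreeGrading) (Ne.symm hk)
              (L.bipart_le_degreePart _ _ htb)]
          rw [ha (h1.trans (map_zero a.toLinearMap).symm)]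
          exact zero_mem _
      have h1 : y - g.toLinearMap z ∈ L.below (m + 1) := by
        have h2 := sub_mem hlow (hQ hzQ).2
        rw [hz] at h2
        simpa using h2
      have h3 := ih _ (sub_mem hynJ (g.toLinearMap z).2) h1
      have h4 := add_mem h3 (⟨z, rfl⟩ : (g.toLinearMap z : E) ∈ R)
      rwa [sub_add_cancel] at h4

end BigrLie

open GrSpace GrLie BigrLie in
theorem mainTheorem8 {F : Type u} [Field F] (h6 : (6 : F) ≠ 0)
    {E : Type v} [AddCommGroup E] [Module F E] (L : BigrLie F E)
    (hconn : L.IsConnected) (hft : L.IsFiniteType) (hL : L.IsSemidirectFree)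
    (J : Submodule F E) (hJ : L.IsSubalgebra J) (hJg : L.IsHomogeneous J)
    (hJ0 : J ⊓ L.degreePart 0 = ⊥) :
    (L.restrict J hJ hJg).IsFree := by
  have h2 : (2 : F) ≠ 0 := by
    intro h
    apply h6
    linear_combination 3 * h
  obtain ⟨S, hbase, hι⟩ := hL.exists_freeSemidirect
  have hV := isConnected_degreeSpace hconn 1
  have hJS : J ⊓ S.base = ⊥ := by rw [hbase, hJ0]
  set G := L.topFormSpace J with hGdef
  have hG : L.IsSubalgebra G := isSubalgebra_topFormSpace hJ
  have hGh : L.IsHomogeneous G := isHomogeneous_topFormSpace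
  have hGle : G ≤ LinearMap.range S.f.toLinearMap := topFormSpace_le_range S hι hbase hJ0
  have hGS : G ⊓ S.base = ⊥ := by
    rw [eq_bot_iff, inf_comm, ← S.isCompl.inf_eq_bot]
    exact inf_le_inf_left _ hGle
  -- bihomogeneous elements `t` of `G`, forming a basis modulo brackets
  obtain ⟨t, ht, htspan, htli⟩ := exists_family_linearIndependent_mod (F := F)
    {x | ∃ i j, x ∈ L.topForms J i j} (L.derived G)
  choose d e hde using fun i : t => ht i.2
  have hGt : G ≤ L.derived G ⊔ Submodule.span F t :=
    (iSup_le fun p x hx => Submodule.subset_span ⟨p.1, p.2, hx⟩ :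
      G ≤ Submodule.span F {x | ∃ i j, x ∈ L.topForms J i j}).trans htspan
  have htG : ∀ i : t, (i : E) ∈ G := fun i => Submodule.mem_iSup_of_mem (d i, e i) (hde i)
  have htd : ∀ i : t, (i : E) ∈ L.part (d i) := fun i => L.bipart_le_part _ _ (hde i).1
  choose u huJ hud hut using fun i => (mem_topForms.1 (hde i)).2
  choose w hw using fun i => hGle (htG i)
  have hwli : LinearIndependent (TensorAlgebra F (L.degreePart 1))
      fun i => (w i : TensorAlgebra F (L.degreePart 1)) :=
    linearIndependent_of_le_range h2 hft hV S hG hGh hGle (fun i => (hw i).symm ▸ htG i)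
      (by simpa only [hw] using htli)
  -- the space of generators
  let B := Module.Basis.span (LinearIndependent.of_comp _ htli)
  have hWh : L.IsHomogeneous (Submodule.span F (Set.range ((↑) : t → E))) := by
    refine L.isHomogeneous_span ?_
    rintro _ ⟨i, rfl⟩
    exact ⟨d i, htd i⟩
  let X := L.toGrSpace.restrict _ hWh
  have hBcoe : ∀ i, (B i : E) = i := fun i =>
    congrArg Subtype.val (Module.Basis.span_apply (LinearIndependent.of_comp _ htli) i)
  have hBind : ∀ {T : Submodule F (Submodule.span F (Set.range ((↑) : t → E)))},
      (∀ i, B i ∈ T) → ∀ x, x ∈ T := fun {T} hT x => by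
    have : Submodule.span F (Set.range B) ≤ T := Submodule.span_le.2 (Set.range_subset_iff.2 hT)
    rw [B.span_eq] at this
    exact this trivial
  -- a map of generators that respects dimensions on the basis does so everywhere
  have hBpart : ∀ (φ : Submodule.span F (Set.range ((↑) : t → E)) →ₗ[F] E),
      (∀ i, φ (B i) ∈ L.part (d i)) → ∀ n, ∀ x ∈ X.part n, φ x ∈ L.part n := by
    intro φ hφ n x hx
    have h1 : φ ∘ₗ X.proj n = L.proj n ∘ₗ φ := by
      refine B.ext fun i => ?_
      have hi : B i ∈ X.part (d i) := by
        change (B i : E) ∈ L.part (d i)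
        rw [hBcoe]
        exact htd i
      by_cases h : d i = n
      · subst h
        rw [LinearMap.comp_apply, LinearMap.comp_apply, proj_of_mem hi, proj_of_mem (hφ i)]
      · rw [LinearMap.comp_apply, LinearMap.comp_apply, proj_of_mem_ne h hi,
          proj_of_mem_ne h (hφ i), map_zero]
    have h3 := LinearMap.congr_fun h1 x
    rw [LinearMap.comp_apply, LinearMap.comp_apply, proj_of_mem hx] at h3
    rw [h3]
    exact proj_mem n _
  let υ := B.constr F u
  have hυ : ∀ i, υ (B i) = u i := fun i => B.constr_basis F u i
  obtain ⟨g, hgι, -⟩ := S.exists_hom hV hJ hJg hJS X υ fun n x hx =>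
    ⟨hBind (T := J.comap υ) (fun i => by rw [Submodule.mem_comap, hυ]; exact huJ i) x,
      hBpart υ (fun i => by rw [hυ]; exact hud i) n x hx⟩
  obtain ⟨a, haι, hrho⟩ := S.exists_hom hV hG hGh hGS X (Submodule.subtype _) fun n x hx =>
    ⟨hBind (T := G.comap (Submodule.subtype _))
      (fun i => by rw [Submodule.mem_comap, Submodule.subtype_apply, hBcoe]; exact htG i) x, hx⟩
  let a' : Hom X.freeLie L.toGrLie :=
    ⟨G.subtype ∘ₗ a.toLinearMap, fun n x hx => a.map_part n x hx,
      fun x y => congrArg Subtype.val (a.map_br x y)⟩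
  have ha'ι : ∀ x, a'.toLinearMap (X.freeLieι x) = x := haι
  -- `a` is injective, as the elements `w` generate a free associative algebra
  have ha' : Function.Injective a'.toLinearMap := by
    let h := B.constr F fun i => (w i : TensorAlgebra F (L.degreePart 1))
    have hh : ∀ i, h (B i) = w i := fun i => B.constr_basis F _ i
    have hinj : Function.Injective (TensorAlgebra.lift F h) := by
      refine TensorAlgebra.lift_injective_of_linearIndependent TensorAlgebra.algebraMapInv B h
        (fun x => ?_) (by simpa only [hh] using hwli)
      refine hBind (T := (augIdeal F _).comap h) (fun i => ?_) x
      rw [Submodule.mem_comap, hh]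
      exact freeLieSpace_le_augIdeal _ (w i).2
    have hlift : TensorAlgebra.lift F (S.rho ∘ₗ Submodule.subtype _) =
        (Algebra.lmul F _).comp (TensorAlgebra.lift F h) := by
      refine TensorAlgebra.hom_ext (B.ext fun i => LinearMap.ext fun x => ?_)
      have h3 := S.rho_f (w i) x
      rw [hw] at h3
      simpa [hh, hBcoe] using h3
    rw [injective_iff_map_eq_zero]
    intro z hz
    have h4 := hrho z
    have h5 : (a.toLinearMap z : E) = 0 := hz
    rw [h5, map_zero, hlift] at h4
    have h6 := LinearMap.congr_fun h4 1
    refine Subtype.ext (hinj ?_)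
    simpa using h6.symm
  have haG : G ≤ LinearMap.range a'.toLinearMap := by
    refine le_of_le_derived_sup_span (fun n hn => ?_) hGh (fun x hx => ⟨d ⟨x, hx⟩, htd ⟨x, hx⟩⟩)
      hGt (fun x hx => ⟨X.freeLieι (B ⟨x, hx⟩), ?_⟩) ?_
    · rw [hconn n hn, inf_bot_eq]
    · rw [ha'ι, hBcoe]
    · rintro i j _ ⟨-, z, rfl⟩ - _ ⟨-, z', rfl⟩ -
      exact ⟨X.freeLie.br z z', a'.map_br z z'⟩
  refine ⟨_, _, _, X, g, bijective_of_top_degree hJ hJg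
    (fun y hy hy1 => eq_zero_of_mem_below_one S hι hbase hJ0 hy hy1) a' ha' haG g ?_⟩
  rintro _ ⟨x, rfl⟩
  refine hBind (T := Submodule.comap X.freeLieι (⨆ j, (L.degreePart j).comap a'.toLinearMap ⊓
    (L.below j).comap (J.subtype ∘ₗ g.toLinearMap - a'.toLinearMap))) (fun i => ?_) x
  refine Submodule.mem_iSup_of_mem (e i) ⟨?_, ?_⟩
  · change a'.toLinearMap (X.freeLieι (B i)) ∈ L.degreePart (e i)
    rw [ha'ι, hBcoe]
    exact L.bipart_le_degreePart _ _ (hde i).1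
  · change (g.toLinearMap (X.freeLieι (B i)) : E) -
      a'.toLinearMap (X.freeLieι (B i)) ∈ L.below (e i)
    rw [ha'ι, hBcoe, hgι, hυ]
    exact hut i
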